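/- For a finite simple graph $G=(V,E)$ let $\mathcal F\subseteq 2^V$ be the set of all stable sets of $G$, i.e. of all sets of pairwise non-adjacent vertices. The problem Unweighted Robust Stable Set on $G$ is $$\max_{S\in\mathcal F}\ \min_{f\in V\cup\{\emptyset\}}\ \max_{\substack{e\in (V\setminus (S+f))\cup\{\emptyset\}\\ S-f+e\in\mathcal F}}\ |S-f+e|,$$ where $X+x=X\cup\{x\}$ and $X-x=X\setminus\{x\}$, and where $f=\emptyset$ (respectively $e=\emptyset$) means that no vertex is deleted (respectively added). To solve the problem means to output a stable set $S$ that attains the outer maximum, together with the value of the maximum. A graph is a König–Egerváry graph if the minimum size of a vertex cover equals the maximum size of a matching. **Corollary 5.3.** Unweighted Robust Stable Set is solvable in polynomial time on König–Egerváry graphs: there are an algorithm (a program for a random access machine with addition, truncated subtraction and indirect addressing, at unit cost per elementary operation) and a polynomial $p$ such that, for every $n$ and every König–Egerváry graph $G$ on the vertex set $\{0,\dots,n-1\}$, the algorithm, given $n$ and the adjacency matrix of $G$, halts after at most $p(n)$ steps and outputs an optimal first-stage stable set $S$ together with the optimal value. -/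

import Mathlib

open scoped NNReal

noncomputable section

namespace RecoverableRobust

/-! ### Recoverable robust optimization with commitment (one interdiction, one recourse) -/

section Robust

open Classical in
/-- `S - f`, where `f = none` means that no element is interdicted. -/
def interdict {E : Type*} (S : Finset E) : Option E → Finset E
  | none => S
  | some f => S.erase f

open Classical in
/-- `S - f + e`, where `none` means that nothing is deleted (resp. added). -/
def secondStage {E : Type*} (S : Finset E) (f : Option E) : Option E → Finset E
  | none => interdict S f
  | some e => insert e (interdict S f)

/-- The recourse `e` may answer the interdiction `f` of `S`: either `e = none`, or `e` is an element
of `E \ (S + f)`; in both cases the resulting set `S - f + e` has to be feasible. -/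
def IsRecourse {E : Type*} (F : Set (Finset E)) (S : Finset E) (f e : Option E) : Prop :=
  (∀ x, e = some x → x ∉ S ∧ f ≠ some x) ∧ secondStage S f e ∈ F

open Classical in
/-- The maximum of `w (S - f + e)` over all recourses `e` that may answer `f`. (If `F` is closed
under taking subsets and `S ∈ F`, then `e = none` is always available, so that this is a maximum over
a non-empty finite set.) -/
def bestRecourse {E : Type*} [Fintype E] (F : Set (Finset E)) (w : E → ℝ≥0) (S : Finset E)
    (f : Option E) : ℝ≥0 :=
  (Finset.univ.filter fun e : Option E => IsRecourse F S f e).sup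
    fun e => ∑ x ∈ secondStage S f e, w x

/-- The worst-case second-stage weight of the first-stage solution `S`:
`min_{f ∈ E ∪ ∅} max_e w (S - f + e)`. -/
def worstCaseWeight {E : Type*} [Fintype E] (F : Set (Finset E)) (w : E → ℝ≥0) (S : Finset E) :
    ℝ≥0 :=
  (Finset.univ : Finset (Option E)).inf' ⟨none, Finset.mem_univ none⟩ (bestRecourse F w S)

/-- `S` is an optimal first-stage solution of the robust counterpart
`max_{S ∈ F} min_{f ∈ E ∪ ∅} max_e w (S - f + e)`. -/
def IsRobustOptimal {E : Type*} [Fintype E] (F : Set (Finset E)) (w : E → ℝ≥0) (S : Finset E) :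
    Prop :=
  S ∈ F ∧ ∀ T ∈ F, worstCaseWeight F w T ≤ worstCaseWeight F w S

end Robust

/-! ### Graphs -/

section Graphs

/-- The feasible sets of the stable set problem in `G`. -/
def stableSets {V : Type*} (G : SimpleGraph V) : Set (Finset V) :=
  {S | G.IsIndepSet (S : Set V)}

/-- The maximum number of edges of a matching of `G`. -/
def matchingNumber {V : Type*} (G : SimpleGraph V) : ℕ∞ :=
  ⨆ (M : G.Subgraph) (_ : M.IsMatching), M.edgeSet.encard

/-- A König–Egerváry graph: the minimum size of a vertex cover equals the maximum size of a
matching. -/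
def IsKonigEgervary {V : Type*} (G : SimpleGraph V) : Prop :=
  G.vertexCoverNum = matchingNumber G

end Graphs

/-! ### Random access machines

Structured programs for a random access machine: registers and arrays of natural numbers, addition,
truncated subtraction, indirect addressing, branching and loops. There is deliberately no
multiplication, so that a number can at most double in a step; the uniform cost of this machine is
therefore polynomially related to the running time of Turing machines. -/

/-- A machine state: the registers, and countably many one-dimensional arrays (a program refers to
finitely many of them, by fixed names). -/
structure State where
  /-- `reg x` is the content of register `x`. -/
  reg : ℕ → ℕ
  /-- `arr a i` is the content of cell `i` of the array named `a`. -/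
  arr : ℕ → ℕ → ℕ

/-- Expressions: constants, registers, array cells, addition and truncated subtraction. -/
inductive Expr where
  | const (c : ℕ)
  | reg (x : ℕ)
  | cell (a : ℕ) (i : Expr)
  | add (e₁ e₂ : Expr)
  | sub (e₁ e₂ : Expr)

/-- The value of an expression in a state. -/
def Expr.eval (s : State) : Expr → ℕ
  | .const c => c
  | .reg x => s.reg x
  | .cell a i => s.arr a (i.eval s)
  | .add e₁ e₂ => e₁.eval s + e₂.eval s
  | .sub e₁ e₂ => e₁.eval s - e₂.eval s

/-- The number of elementary operations needed to evaluate an expression. -/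
def Expr.cost : Expr → ℕ
  | .const _ => 1
  | .reg _ => 1
  | .cell _ i => i.cost + 1
  | .add e₁ e₂ => e₁.cost + e₂.cost + 1
  | .sub e₁ e₂ => e₁.cost + e₂.cost + 1

/-- Programs. A condition is an expression, and it holds if its value is nonzero. -/
inductive Program where
  | skip
  | assign (x : ℕ) (e : Expr)
  | store (a : ℕ) (i e : Expr)
  | seq (p q : Program)
  | ite (c : Expr) (p q : Program)
  | loop (c : Expr) (p : Program)

/-- The state after register `x` has been set to `v`. -/
def State.setReg (s : State) (x v : ℕ) : State :=
  { s with reg := Function.update s.reg x v }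

/-- The state after cell `i` of the array `a` has been set to `v`. -/
def State.setCell (s : State) (a i v : ℕ) : State :=
  { s with arr := Function.update s.arr a (Function.update (s.arr a) i v) }

/-- `Runs p s s' t`: the program `p`, started in the state `s`, halts in the state `s'` after exactly
`t` steps. Every elementary operation, assignment, store and test of a condition counts. -/
inductive Runs : Program → State → State → ℕ → Prop
  | skip (s : State) : Runs .skip s s 1
  | assign (x : ℕ) (e : Expr) (s : State) :
      Runs (.assign x e) s (s.setReg x (e.eval s)) (e.cost + 1)
  | store (a : ℕ) (i e : Expr) (s : State) :
      Runs (.store a i e) s (s.setCell a (i.eval s) (e.eval s)) (i.cost + e.cost + 1)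
  | seq {p q : Program} {s s' s'' : State} {t t' : ℕ} :
      Runs p s s' t → Runs q s' s'' t' → Runs (.seq p q) s s'' (t + t')
  | ite_true {c : Expr} {p q : Program} {s s' : State} {t : ℕ} :
      c.eval s ≠ 0 → Runs p s s' t → Runs (.ite c p q) s s' (c.cost + 1 + t)
  | ite_false {c : Expr} {p q : Program} {s s' : State} {t : ℕ} :
      c.eval s = 0 → Runs q s s' t → Runs (.ite c p q) s s' (c.cost + 1 + t)
  | loop_done {c : Expr} {p : Program} {s : State} :
      c.eval s = 0 → Runs (.loop c p) s s (c.cost + 1)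
  | loop_step {c : Expr} {p : Program} {s s' s'' : State} {t t' : ℕ} :
      c.eval s ≠ 0 → Runs p s s' t → Runs (.loop c p) s' s'' t' →
      Runs (.loop c p) s s'' (c.cost + 1 + t + t')

/-! ### Input and output -/

open Classical in
/-- The initial state for a graph on `{0, …, n - 1}`: register `0` holds `n`, array `0` holds the
adjacency matrix row by row, and everything else is `0`. -/
def inputState {n : ℕ} (G : SimpleGraph (Fin n)) : State where
  reg x := if x = 0 then n else 0
  arr a i := if a = 0 ∧ ∃ u v : Fin n, i = u.val * n + v.val ∧ G.Adj u v then 1 else 0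

/-- The vertex set that a state holds in array `1`, given by its characteristic vector. -/
def outputSet (n : ℕ) (s : State) : Finset (Fin n) :=
  Finset.univ.filter fun v => s.arr 1 v.val ≠ 0

/-- The number that a state holds in register `0`. -/
def outputValue (s : State) : ℕ := s.reg 0

/-- The program `P` solves unweighted robust stable set on the graph `G` within `T` steps: it halts
after at most `T` steps, and outputs an optimal first-stage solution and the optimal value. -/
def SolvesUnweightedRobustStableSet (P : Program) {n : ℕ} (G : SimpleGraph (Fin n)) (T : ℕ) : Prop :=
  ∃ (s : State) (t : ℕ), Runs P (inputState G) s t ∧ t ≤ T ∧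
    IsRobustOptimal (stableSets G) (fun _ => 1) (outputSet n s) ∧
    (outputValue s : ℝ≥0) = worstCaseWeight (stableSets G) (fun _ => 1) (outputSet n s)

end RecoverableRobust

end

/-! Let α be the stability number. Deleting nothing shows that no first-stage set is worth more than
α, and a maximum stable set is worth at least α - 1, since a deletion costs at most one vertex. So
the optimum is α or α - 1. It is α exactly if some maximum stable set T has private neighbours: when
f is deleted from T, only a vertex whose sole neighbour in T is f can replace it
(`card_le_worstCaseWeight`, `exists_hasPrivateNeighbors`).

For König–Egerváry graphs this is easy to recognize. Their maximum stable sets are tight: no stable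
set of the bipartite double cover, here a stable pair (A, B), is larger than 2α
(`IsKonigEgervary.exists_isTight`). The pair (V, ∅) gives |V| ≤ 2α, so the private neighbours of T
fill the complement of T, every vertex of T is a leaf, and G is a corona
(`isCorona_of_hasPrivateNeighbors`). Conversely, the leaves of a corona, one from each component
that is an edge, form a maximum stable set with private neighbours (`IsCorona.isRobustOptimal`). If
G is not a corona, every maximum stable set is optimal, of value α - 1.

It remains to find a maximum stable set. The maximum size of a stable pair is a bipartite matching
problem, solved by an auction whose final prices certify optimality
(`isStablePairNumber_of_prices`). A vertex v of H is taken if deleting its closed neighbourhood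
lowers this number by exactly 2, and discarded otherwise. This is correct because the majority of a
maximum stable pair and a tight stable set is again tight (`IsTight.majority`), so a v lying on both
sides of some maximum pair also lies in a tight stable set.

The programs are written in a language of bounded loops, where termination and a polynomial time
bound are automatic (`exists_runs_compile`), and are verified on its denotational semantics. -/

namespace RecoverableRobust

/-! ### Programs with bounded loops -/

@[simp] theorem State.setReg_reg (s : State) (x v y : ℕ) :
    (s.setReg x v).reg y = if y = x then v else s.reg y := by
  simp [State.setReg, Function.update_apply]

@[simp] theorem State.setReg_arr (s : State) (x v : ℕ) : (s.setReg x v).arr = s.arr := rfl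

@[simp] theorem State.setCell_reg (s : State) (a i v : ℕ) : (s.setCell a i v).reg = s.reg := rfl

@[simp] theorem State.setCell_arr (s : State) (a i v b : ℕ) :
    (s.setCell a i v).arr b = if b = a then Function.update (s.arr a) i v else s.arr b := by
  by_cases h : b = a
  · subst h; simp [State.setCell]
  · simp [State.setCell, h]

/-- Programs all of whose loops are bounded: `loop x c p` runs `p` with register `x` ranging over
`0, …, n + c - 1`, where `n` is the content of register `0`. -/
inductive ForProgram where
  | skip
  | assign (x : ℕ) (e : Expr)
  | store (a : ℕ) (i e : Expr)
  | seq (p q : ForProgram)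
  | ite (c : Expr) (p q : ForProgram)
  | loop (x c : ℕ) (p : ForProgram)

/-- The iterates of a loop body `b` with loop register `x`. -/
def loopState (b : State → State) (x : ℕ) : ℕ → State → State
  | 0, s => s.setReg x 0
  | i + 1, s => (b (loopState b x i s)).setReg x (i + 1)

namespace ForProgram

/-- The translation into a program of the random access machine. -/
def compile : ForProgram → Program
  | skip => .skip
  | assign x e => .assign x e
  | store a i e => .store a i e
  | seq p q => .seq p.compile q.compile
  | ite c p q => .ite c p.compile q.compile
  | loop x c p => .seq (.assign x (.const 0))
      (.loop (.sub (.add (.reg 0) (.const c)) (.reg x))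
        (.seq p.compile (.assign x (.add (.reg x) (.const 1)))))

/-- The state transformation computed by a program. -/
def den : ForProgram → State → State
  | skip, s => s
  | assign x e, s => s.setReg x (e.eval s)
  | store a i e, s => s.setCell a (i.eval s) (e.eval s)
  | seq p q, s => q.den (p.den s)
  | ite c p q, s => if c.eval s ≠ 0 then p.den s else q.den s
  | loop x c p, s => loopState p.den x (s.reg 0 + c) s

theorem den_seq (p q : ForProgram) (s : State) : (seq p q).den s = q.den (p.den s) := rfl

theorem den_assign (x : ℕ) (e : Expr) (s : State) :
    (assign x e).den s = s.setReg x (e.eval s) := rfl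

/-- Whether a program may change register `x`. -/
def writesReg (y : ℕ) : ForProgram → Bool
  | skip => false
  | assign x _ => x == y
  | store _ _ _ => false
  | seq p q => p.writesReg y || q.writesReg y
  | ite _ p q => p.writesReg y || q.writesReg y
  | loop x _ p => x == y || p.writesReg y

/-- Whether a program may change array `a`. -/
def writesArr (b : ℕ) : ForProgram → Bool
  | skip => false
  | assign _ _ => false
  | store a _ _ => a == b
  | seq p q => p.writesArr b || q.writesArr b
  | ite _ p q => p.writesArr b || q.writesArr b
  | loop _ _ p => p.writesArr b

/-- A program is well formed if it does not change register `0`, nor, in the body of a loop, the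
register of that loop. -/
def wf : ForProgram → Bool
  | skip => true
  | assign x _ => x != 0
  | store _ _ _ => true
  | seq p q => p.wf && q.wf
  | ite _ p q => p.wf && q.wf
  | loop x _ p => x != 0 && !p.writesReg x && p.wf

/-- A bound for the running time, as a polynomial in the content of register `0`. -/
noncomputable def cost : ForProgram → Polynomial ℕ
  | skip => 1
  | assign _ e => (e.cost + 1 : ℕ)
  | store _ i e => (i.cost + e.cost + 1 : ℕ)
  | seq p q => p.cost + q.cost
  | ite c p q => (c.cost + 1 : ℕ) + p.cost + q.cost
  | loop _ c p => 8 + (Polynomial.X + (c : Polynomial ℕ)) * (10 + p.cost)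

/-- Frame rule. As `writesReg` is a Boolean computation, its hypothesis is closed by `rfl` for a
concrete program. -/
theorem den_reg_of_not_writes {y : ℕ} (p : ForProgram) (s : State) (h : p.writesReg y = false) :
    (p.den s).reg y = s.reg y := by
  induction p generalizing s with
  | skip => rfl
  | assign x e =>
    have : y ≠ x := by rintro rfl; simp [writesReg] at h
    simp [den, this]
  | store a i e => rfl
  | seq p q hp hq =>
    simp only [writesReg, Bool.or_eq_false_iff] at h
    simp only [den]
    rw [hq _ h.2, hp _ h.1]
  | ite c p q hp hq =>
    simp only [writesReg, Bool.or_eq_false_iff] at h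
    simp only [den]
    split_ifs
    · exact hp _ h.1
    · exact hq _ h.2
  | loop x c p hp =>
    simp only [writesReg, Bool.or_eq_false_iff, beq_eq_false_iff_ne] at h
    have hy : y ≠ x := fun e => h.1 e.symm
    simp only [den]
    generalize s.reg 0 + c = N
    induction N with
    | zero => simp [loopState, hy]
    | succ i ih => simp [loopState, hy, hp _ h.2, ih]

theorem den_arr_of_not_writes {b : ℕ} (p : ForProgram) (s : State) (h : p.writesArr b = false) :
    (p.den s).arr b = s.arr b := by
  induction p generalizing s with
  | skip => rfl
  | assign x e => rfl
  | store a i e =>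
    have : b ≠ a := by rintro rfl; simp [writesArr] at h
    simp [den, this]
  | seq p q hp hq =>
    simp only [writesArr, Bool.or_eq_false_iff] at h
    simp only [den]
    rw [hq _ h.2, hp _ h.1]
  | ite c p q hp hq =>
    simp only [writesArr, Bool.or_eq_false_iff] at h
    simp only [den]
    split_ifs
    · exact hp _ h.1
    · exact hq _ h.2
  | loop x c p hp =>
    simp only [writesArr] at h
    simp only [den]
    generalize s.reg 0 + c = N
    induction N with
    | zero => simp [loopState]
    | succ i ih => simp [loopState, hp _ h, ih]

theorem writesReg_zero_of_wf (p : ForProgram) (h : p.wf = true) : p.writesReg 0 = false := by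
  induction p with
  | skip => rfl
  | assign x e => simpa [wf, writesReg] using h
  | store a i e => rfl
  | seq p q hp hq =>
    simp only [wf, Bool.and_eq_true] at h
    simp [writesReg, hp h.1, hq h.2]
  | ite c p q hp hq =>
    simp only [wf, Bool.and_eq_true] at h
    simp [writesReg, hp h.1, hq h.2]
  | loop x c p hp =>
    simp only [wf, Bool.and_eq_true] at h
    simpa [writesReg, hp h.2] using h.1.1

theorem loopState_reg (b : State → State) (x i : ℕ) (s : State) :
    (loopState b x i s).reg x = i := by
  cases i <;> simp [loopState]

theorem loopState_reg_zero (p : ForProgram) (x i : ℕ) (s : State) (hx : x ≠ 0)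
    (h : p.wf = true) : (loopState p.den x i s).reg 0 = s.reg 0 := by
  induction i with
  | zero => simp [loopState, hx.symm]
  | succ i ih =>
    simp [loopState, hx.symm, den_reg_of_not_writes p _ (writesReg_zero_of_wf p h), ih]

theorem loopState_reg_of_not_writes (p : ForProgram) (x i y : ℕ) (s : State) (hy : y ≠ x)
    (h : p.writesReg y = false) : (loopState p.den x i s).reg y = s.reg y := by
  induction i with
  | zero => simp [loopState, hy]
  | succ i ih => simp [loopState, hy, den_reg_of_not_writes p _ h, ih]

theorem loopState_arr_of_not_writes (p : ForProgram) (x i b : ℕ) (s : State)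
    (h : p.writesArr b = false) : (loopState p.den x i s).arr b = s.arr b := by
  induction i with
  | zero => simp [loopState]
  | succ i ih => simp [loopState, den_arr_of_not_writes p _ h, ih]

/-- The invariant rule for bounded loops. -/
theorem loop_induction {p : ForProgram} {x c : ℕ} {s : State} {n : ℕ} (I : ℕ → State → Prop)
    (hwf : (loop x c p).wf = true) (hn : s.reg 0 = n) (h0 : I 0 (s.setReg x 0))
    (hstep : ∀ i s', i < n + c → s'.reg x = i → s'.reg 0 = n →
      (∀ y, y ≠ x → p.writesReg y = false → s'.reg y = s.reg y) →
      (∀ b, p.writesArr b = false → s'.arr b = s.arr b) → I i s' →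
      I (i + 1) ((p.den s').setReg x (i + 1))) :
    I (n + c) ((loop x c p).den s) := by
  simp only [wf, Bool.and_eq_true, bne_iff_ne] at hwf
  simp only [den, hn]
  have key : ∀ i, i ≤ n + c → I i (loopState p.den x i s) := by
    intro i
    induction i with
    | zero => intro _; exact h0
    | succ i ih =>
      intro hi
      exact hstep i _ (by omega) (loopState_reg _ _ _ _)
        ((loopState_reg_zero p x i s hwf.1.1 hwf.2).trans hn)
        (fun y hy h => loopState_reg_of_not_writes p x i y s hy h)
        (fun b h => loopState_arr_of_not_writes p x i b s h) (ih (by omega))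
  exact key _ le_rfl

/-- Register `0` and the loop register are untouched by a loop body, so the number of passes is
fixed on entry. This gives both halting and the polynomial bound. -/
theorem exists_runs_compile (p : ForProgram) (s : State) (h : p.wf = true) :
    ∃ t ≤ p.cost.eval (s.reg 0), Runs p.compile s (p.den s) t := by
  induction p generalizing s with
  | skip => exact ⟨1, by simp [cost], .skip s⟩
  | assign x e => exact ⟨_, by simp [cost], .assign x e s⟩
  | store a i e => exact ⟨_, by simp [cost], .store a i e s⟩
  | seq p q hp hq =>
    simp only [wf, Bool.and_eq_true] at h
    obtain ⟨t, ht, hr⟩ := hp s h.1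
    obtain ⟨t', ht', hr'⟩ := hq (p.den s) h.2
    rw [den_reg_of_not_writes p s (writesReg_zero_of_wf p h.1)] at ht'
    exact ⟨t + t', by simp only [cost, Polynomial.eval_add]; omega, .seq hr hr'⟩
  | ite c p q hp hq =>
    simp only [wf, Bool.and_eq_true] at h
    simp only [cost, den, Polynomial.eval_add, Polynomial.eval_natCast, Nat.cast_id, compile]
    split_ifs with hc
    · obtain ⟨t, ht, hr⟩ := hp s h.1
      exact ⟨_, by omega, .ite_true hc hr⟩
    · obtain ⟨t, ht, hr⟩ := hq s h.2
      exact ⟨_, by omega, .ite_false (not_not.1 hc) hr⟩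
  | loop x c p hp =>
    simp only [wf, Bool.and_eq_true, bne_iff_ne, Bool.not_eq_true'] at h
    obtain ⟨⟨hx, hpx⟩, hpw⟩ := h
    have hx' : (0 : ℕ) ≠ x := hx.symm
    set N := s.reg 0 + c with hN
    set T := p.cost.eval (s.reg 0) with hT
    -- Here `d` is the number of passes left. A pass costs 6 for the test and 4 for the increment
    -- besides the body; the last test costs 6, and the initial assignment 2 more.
    have key : ∀ d i, i + d = N → ∃ t ≤ 6 + d * (10 + T),
        Runs (.loop (.sub (.add (.reg 0) (.const c)) (.reg x))
          (.seq p.compile (.assign x (.add (.reg x) (.const 1)))))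
          (loopState p.den x i s) (loopState p.den x N s) t := by
      intro d
      induction d with
      | zero =>
        intro i hi
        obtain rfl : i = N := by omega
        refine ⟨6, by omega, .loop_done ?_⟩
        simp [Expr.eval, loopState_reg, loopState_reg_zero p x _ s hx hpw, hN]
      | succ d ih =>
        intro i hi
        obtain ⟨t', ht', hr'⟩ := ih (i + 1) (by omega)
        obtain ⟨t, ht, hr⟩ := hp (loopState p.den x i s) hpw
        rw [loopState_reg_zero p x _ s hx hpw, ← hT] at ht
        have hb := Runs.seq hr (.assign x (.add (.reg x) (.const 1)) _)
        have hv : (Expr.add (.reg x) (.const 1)).eval (p.den (loopState p.den x i s)) = i + 1 := by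
          simp [Expr.eval, den_reg_of_not_writes p _ hpx, loopState_reg]
        rw [hv] at hb
        refine ⟨_, ?_, .loop_step ?_ hb hr'⟩
        · simp only [Expr.cost]
          have : (d + 1) * (10 + T) = d * (10 + T) + (10 + T) := by ring
          omega
        · simp only [Expr.eval, loopState_reg, loopState_reg_zero p x _ s hx hpw]
          omega
    obtain ⟨t, ht, hr⟩ := key N 0 (by omega)
    refine ⟨_, ?_, .seq (.assign x (.const 0) s) hr⟩
    simp only [cost, Expr.cost, Polynomial.eval_add, Polynomial.eval_mul, Polynomial.eval_X,
      Polynomial.eval_natCast, Polynomial.eval_ofNat, Nat.cast_id, ← hT, ← hN]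
    omega

end ForProgram

/-! ### Boolean conditions: `1 - x` is nonzero exactly if `x` is zero. -/

namespace Expr

/-- Conjunction of conditions. -/
def and (a b : Expr) : Expr :=
  .sub (.const 1) (.add (.sub (.const 1) a) (.sub (.const 1) b))

/-- Negation of a condition. -/
def not (a : Expr) : Expr := .sub (.const 1) a

/-- Equality test. -/
def eq (a b : Expr) : Expr := .sub (.const 1) (.add (.sub a b) (.sub b a))

theorem eval_and (s : State) (a b : Expr) :
    (a.and b).eval s ≠ 0 ↔ a.eval s ≠ 0 ∧ b.eval s ≠ 0 := by
  simp only [Expr.and, eval]; omega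

theorem eval_not (s : State) (a : Expr) : a.not.eval s ≠ 0 ↔ ¬ a.eval s ≠ 0 := by
  simp only [Expr.not, eval]; omega

theorem eval_eq (s : State) (a b : Expr) : (a.eq b).eval s ≠ 0 ↔ a.eval s = b.eval s := by
  simp only [Expr.eq, eval]; omega

/-- Strict comparison. -/
def lt (a b : Expr) : Expr := .sub b a

theorem eval_lt (s : State) (a b : Expr) : (a.lt b).eval s ≠ 0 ↔ a.eval s < b.eval s := by
  simp only [Expr.lt, eval]; omega

end Expr

/-! ### Counting and tabulating. -/

namespace ForProgram

/-- A conditional without alternative. -/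
def when (c : Expr) (p : ForProgram) : ForProgram := .ite c p .skip

/-- Count in register `r` the `x < n` for which the condition `c` holds. -/
def count (x r : ℕ) (c : Expr) : ForProgram :=
  .seq (.assign r (.const 0)) (.loop x 0 (when c (.assign r (.add (.reg r) (.const 1)))))

theorem den_count_arr (x r : ℕ) (c : Expr) (s : State) : ((count x r c).den s).arr = s.arr := by
  funext b
  exact den_arr_of_not_writes _ _ rfl

theorem den_count_reg {x r : ℕ} {c : Expr} {s : State} {n : ℕ} (P : ℕ → Prop) [DecidablePred P]
    (hn : s.reg 0 = n) (hx : x ≠ 0) (hr : r ≠ 0) (hxr : x ≠ r)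
    (h : ∀ i s', i < n → s'.reg x = i → s'.arr = s.arr →
      (∀ y, y ≠ x → y ≠ r → s'.reg y = s.reg y) → (c.eval s' ≠ 0 ↔ P i)) :
    ((count x r c).den s).reg r = ((Finset.range n).filter P).card := by
  refine loop_induction (n := n) (fun i s' => s'.reg r = ((Finset.range i).filter P).card)
    ?_ ?_ ?_ ?_
  · simp [wf, when, writesReg, hx, hr, hxr.symm]
  · simp [den, hr.symm, hn]
  · simp [den, hxr.symm, Expr.eval]
  · intro i s' hi hxi h0 hreg harr hI
    have harr' : s'.arr = s.arr := funext fun b => harr b rfl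
    have hc := h i s' hi hxi harr' (fun y hy hyr => by
      rw [hreg y hy (by simp [when, writesReg, hyr.symm])]; simp [den, hyr])
    simp only [when, den, State.setReg_reg, hxr.symm, if_false, Finset.range_add_one,
      Finset.filter_insert]
    by_cases hP : P i
    · rw [if_pos (hc.2 hP), if_pos hP]
      simp [Expr.eval, hI]
    · rw [if_neg (fun h => hP (hc.1 h)), if_neg hP, hI]

/-- Set the cells `x < n + c` of array `a` to the value of `e` after `p`, with `x` in register
`1`. -/
def tabulate (a c : ℕ) (p : ForProgram) (e : Expr) : ForProgram :=
  .loop 1 c (.seq p (.store a (.reg 1) e))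

/-- A relation `R` instead of a function allows entries to be specified only up to a property, such
as being nonzero. Nothing is assumed about the array being overwritten or about the scratch
registers of `p`. -/
theorem den_tabulate {a c : ℕ} {p : ForProgram} {e : Expr} {s : State} {n : ℕ}
    (R : ℕ → ℕ → Prop) (hn : s.reg 0 = n) (hp : p.wf = true) (hp1 : p.writesReg 1 = false)
    (hpa : ∀ b, p.writesArr b = false)
    (h : ∀ (i : ℕ) (s' : State), i < n + c → s'.reg 0 = n → s'.reg 1 = i →
      (∀ b, b ≠ a → s'.arr b = s.arr b) →
      (∀ y, y ≠ 1 → p.writesReg y = false → s'.reg y = s.reg y) → R i (e.eval (p.den s')))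
    {i : ℕ} (hi : i < n + c) : R i (((tabulate a c p e).den s).arr a i) := by
  refine loop_induction (n := n) (fun j s' => ∀ i < j, R i (s'.arr a i)) ?_ hn ?_ ?_ i hi
  · simp [wf, writesReg, hp1, hp]
  · simp
  · intro i s' hi h1 h0 hreg harr hI j hj
    have hF := h i s' hi h0 h1 (fun b hb => harr b (by simp [writesArr, hpa b, hb.symm]))
      (fun y hy hy' => hreg y hy (by simp [writesReg, hy']))
    simp only [den, State.setReg_arr, State.setCell_arr, if_true, Expr.eval,
      den_reg_of_not_writes p _ hp1, h1, Function.update_apply,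
      den_arr_of_not_writes p _ (hpa a)]
    split_ifs with hji
    · rwa [hji]
    · exact hI j (by omega)

theorem card_filter_range {n : ℕ} (P : ℕ → Prop) [DecidablePred P] :
    ((Finset.range n).filter P).card
      = ((Finset.univ : Finset (Fin n)).filter fun v => P v.val).card := by
  rw [Finset.card_filter, Finset.card_filter, Finset.sum_range]

theorem den_count_reg_fin {x r : ℕ} {c : Expr} {s : State} {n : ℕ} (P : Fin n → Prop)
    [DecidablePred P] (hn : s.reg 0 = n) (hx : x ≠ 0) (hr : r ≠ 0) (hxr : x ≠ r)
    (h : ∀ (i : Fin n) (s' : State), s'.reg x = i.val → s'.arr = s.arr →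
      (∀ y, y ≠ x → y ≠ r → s'.reg y = s.reg y) → (c.eval s' ≠ 0 ↔ P i)) :
    ((count x r c).den s).reg r = (Finset.univ.filter P).card := by
  classical
  rw [den_count_reg (fun i => ∃ h : i < n, P ⟨i, h⟩) hn hx hr hxr, card_filter_range]
  · simp
  · intro i s' hi h1 h2 h3
    rw [h ⟨i, hi⟩ s' h1 h2 h3]
    simp [hi]

theorem den_tabulate_fin {a : ℕ} {p : ForProgram} {e : Expr} {s : State} {n : ℕ}
    (R : Fin n → ℕ → Prop) (hn : s.reg 0 = n) (hp : p.wf = true) (hp1 : p.writesReg 1 = false)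
    (hpa : ∀ b, p.writesArr b = false)
    (h : ∀ (i : Fin n) (s' : State), s'.reg 0 = n → s'.reg 1 = i.val →
      (∀ b, b ≠ a → s'.arr b = s.arr b) →
      (∀ y, y ≠ 1 → p.writesReg y = false → s'.reg y = s.reg y) → R i (e.eval (p.den s')))
    (i : Fin n) : R i (((tabulate a 0 p e).den s).arr a i) :=
  den_tabulate (fun j y => ∀ h : j < n, R ⟨j, h⟩ y) hn hp hp1 hpa
    (fun j s' _ h0 h1 h2 h3 hj => h ⟨j, hj⟩ s' h0 h1 h2 h3) i.2 i.2

end ForProgram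

/-! ### Stable pairs -/

section StablePairs

variable {V : Type*} {G : SimpleGraph V}

/-- A pair of vertex sets inside `H` without edges of `G` from the first set to the second, that is,
a stable set of the bipartite double cover of `G[H]`. -/
structure IsStablePair (G : SimpleGraph V) (H A B : Finset V) : Prop where
  left_subset : A ⊆ H
  right_subset : B ⊆ H
  not_adj : ∀ a ∈ A, ∀ b ∈ B, ¬ G.Adj a b

/-- `b` is the maximum total size of a stable pair in `H`. -/
def IsStablePairNumber (G : SimpleGraph V) (H : Finset V) (b : ℕ) : Prop :=
  (∃ A B, IsStablePair G H A B ∧ b ≤ A.card + B.card) ∧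
    ∀ A B, IsStablePair G H A B → A.card + B.card ≤ b

theorem mem_stableSets_iff {S : Finset V} :
    S ∈ stableSets G ↔ ∀ a ∈ S, ∀ b ∈ S, ¬ G.Adj a b := by
  simp only [stableSets, Set.mem_ofPred_eq, SimpleGraph.isIndepSet_iff, Set.Pairwise]
  refine ⟨fun h a ha b hb hab => h ha hb hab.ne hab, fun h a ha b hb _ => h a ha b hb⟩

theorem mem_stableSets_of_subset {S T : Finset V} (h : S ⊆ T) (hT : T ∈ stableSets G) :
    S ∈ stableSets G := by
  rw [mem_stableSets_iff] at *
  exact fun a ha b hb => hT a (h ha) b (h hb)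

theorem IsStablePair.diag {H S : Finset V} (hS : S ∈ stableSets G) (h : S ⊆ H) :
    IsStablePair G H S S :=
  ⟨h, h, mem_stableSets_iff.1 hS⟩

/-- `T` is a stable subset of `H`, and it is maximum among stable pairs, hence among stable sets. -/
structure IsTight (G : SimpleGraph V) (H T : Finset V) : Prop where
  stable : T ∈ stableSets G
  subset : T ⊆ H
  le : ∀ A B, IsStablePair G H A B → A.card + B.card ≤ 2 * T.card

theorem IsTight.card_le {H T S : Finset V} (hT : IsTight G H T) (hS : S ∈ stableSets G)
    (h : S ⊆ H) : S.card ≤ T.card := by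
  have := hT.le S S (.diag hS h)
  omega

theorem IsTight.isStablePairNumber {H T : Finset V} (hT : IsTight G H T) :
    IsStablePairNumber G H (2 * T.card) :=
  ⟨⟨T, T, .diag hT.stable hT.subset, by omega⟩, hT.le⟩

theorem IsStablePairNumber.unique {H : Finset V} {b c : ℕ} (hb : IsStablePairNumber G H b)
    (hc : IsStablePairNumber G H c) : b = c := by
  obtain ⟨⟨A, B, h, h'⟩, h2⟩ := hb
  obtain ⟨⟨A', B', k, k'⟩, k2⟩ := hc
  have := h2 _ _ k
  have := k2 _ _ h
  omega

/-- Uncrossing a maximum stable pair with a tight stable set. -/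
theorem IsTight.majority [DecidableEq V] {H T A B : Finset V} (hT : IsTight G H T) (hp : IsStablePair G H A B)
    (hcard : 2 * T.card ≤ A.card + B.card) : IsTight G H ((A ∩ B) ∪ (T ∩ (A ∪ B))) := by
  have hTs := mem_stableSets_iff.1 hT.stable
  have hn := hp.not_adj
  have hA := hp.left_subset
  have hB := hp.right_subset
  have hTH := hT.subset
  have hAT : IsStablePair G H (A ∩ T) (B ∪ T) := by
    refine ⟨Finset.inter_subset_left.trans hA, Finset.union_subset hB hTH, ?_⟩
    intro a ha b hb
    simp only [Finset.mem_inter, Finset.mem_union] at ha hb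
    rcases hb with hb | hb
    · exact hn a ha.1 b hb
    · exact hTs a ha.2 b hb
  have hBT : IsStablePair G H (B ∩ T) (A ∪ T) := by
    refine ⟨Finset.inter_subset_left.trans hB, Finset.union_subset hA hTH, ?_⟩
    intro a ha b hb
    simp only [Finset.mem_inter, Finset.mem_union] at ha hb
    rcases hb with hb | hb
    · exact fun h => hn b hb a ha.1 h.symm
    · exact hTs a ha.2 b hb
  have hmix : IsStablePair G H ((A ∩ T) ∩ (B ∩ T)) ((A ∪ T) ∪ (B ∪ T)) := by
    refine ⟨(Finset.inter_subset_left.trans hAT.left_subset),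
      Finset.union_subset hBT.right_subset hAT.right_subset, ?_⟩
    intro a ha b hb
    rw [Finset.mem_inter] at ha
    rcases Finset.mem_union.1 hb with hb | hb
    · exact hBT.not_adj a ha.2 b hb
    · exact hAT.not_adj a ha.1 b hb
  have e1 := hT.le _ _ hmix
  set M := (A ∩ B) ∪ (T ∩ (A ∪ B)) with hM
  -- Every element of `M` lies in at least two of `A`, `B`, `T`. Hence any two elements lie both in
  -- `T` or on opposite sides of the pair.
  have hMs : M ∈ stableSets G := by
    rw [mem_stableSets_iff]
    intro a ha b hb hab
    have k1 := hn a
    have k2 := hTs a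
    have k3 := hn b
    simp only [hM, Finset.mem_inter, Finset.mem_union] at ha hb
    have hba := hab.symm
    by_cases haT : a ∈ T
    · by_cases hbT : b ∈ T
      · exact hTs a haT b hbT hab
      · have : b ∈ A ∧ b ∈ B := by tauto
        rcases (by tauto : a ∈ A ∨ a ∈ B) with h | h
        · exact hn a h b this.2 hab
        · exact hn b this.1 a h hba
    · have : a ∈ A ∧ a ∈ B := by tauto
      rcases (by tauto : b ∈ A ∨ b ∈ B) with h | h
      · exact hn b h a this.2 hba
      · exact hn a this.1 b h hab
  have hMH : M ⊆ H := by
    intro a ha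
    simp only [hM, Finset.mem_inter, Finset.mem_union] at ha
    rcases ha with h | h
    · exact hA h.1
    · exact hTH h.1
  refine ⟨hMs, hMH, fun A' B' h' => ?_⟩
  -- the pair of the two joins and the two meets has the size of the original pairs
  have hmeet : IsStablePair G H ((A ∪ T) ∩ (B ∪ T)) ((A ∩ T) ∪ (B ∩ T)) := by
    refine ⟨Finset.inter_subset_left.trans hBT.right_subset,
      Finset.union_subset hAT.left_subset hBT.left_subset, ?_⟩
    intro a ha b hb hab
    rw [Finset.mem_inter] at ha
    rcases Finset.mem_union.1 hb with hb | hb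
    · exact hAT.not_adj b hb a ha.2 hab.symm
    · exact hBT.not_adj b hb a ha.1 hab.symm
  have e2 := hT.le _ _ hmeet
  have e3 := hT.le _ _ h'
  have c1 := Finset.card_union_add_card_inter A T
  have c2 := Finset.card_union_add_card_inter B T
  have c3 := Finset.card_union_add_card_inter (A ∩ T) (B ∩ T)
  have c4 := Finset.card_union_add_card_inter (A ∪ T) (B ∪ T)
  have c7 : M.card + T.card = ((A ∪ T) ∩ (B ∪ T)).card + ((A ∩ T) ∪ (B ∩ T)).card := by
    rw [← Finset.card_union_add_card_inter M T]
    congr 2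
    · ext x; simp only [hM, Finset.mem_inter, Finset.mem_union]; tauto
    · ext x; simp only [hM, Finset.mem_inter, Finset.mem_union]; tauto
  -- The pairs of `hmix` and `hmeet` have total size |A| + |B| + 2|T| ≥ 4|T|, while each has size at
  -- most 2|T|. So both attain 2|T|, and `c7` yields |M| = |T|.
  omega

section Fintype

variable [Fintype V]

-- `T` is the complement of a minimum vertex cover `C`, and `M` is a maximum matching on the vertex
-- set `W`. A pair has at most |W| = 2|M| elements inside `W`, counted over both sides, and at most
-- 2(|V| - |W|) outside. The sum is 2|V| - 2|M|, which is at most 2|V| - 2|C| = 2|T|.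
open Classical in
theorem IsKonigEgervary.exists_isTight (h : IsKonigEgervary G) :
    ∃ T, IsTight G Finset.univ T := by
  obtain ⟨C, hC, hcov⟩ := G.vertexCoverNum_exists
  have hfin : ∃ M : G.Subgraph, M.IsMatching ∧ matchingNumber G ≤ M.edgeSet.encard := by
    have : Nonempty {M : G.Subgraph // M.IsMatching} :=
      ⟨⟨⊥, fun v hv => by simp at hv⟩⟩
    have hlt : matchingNumber G ≠ ⊤ := h ▸ G.vertexCoverNum_ne_top_of_finite
    obtain ⟨⟨M, hM⟩, hMe⟩ := ENat.exists_eq_iSup_of_lt_top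
      (f := fun M : {M : G.Subgraph // M.IsMatching} => M.1.edgeSet.encard)
      (by rw [iSup_subtype]; exact lt_top_iff_ne_top.2 hlt)
    refine ⟨M, hM, ?_⟩
    rw [iSup_subtype] at hMe
    exact hMe.ge
  obtain ⟨M, hM, hMe⟩ := hfin
  set W : Finset V := Finset.univ.filter (· ∈ M.verts) with hW
  have hWc : W.card = 2 * M.edgeSet.ncard := by
    have h1 := M.spanningCoe.sum_degrees_eq_twice_card_edges
    have h2 : M.spanningCoe.edgeFinset.card = M.edgeSet.ncard := by
      rw [← SimpleGraph.Subgraph.edgeSet_spanningCoe, ← SimpleGraph.coe_edgeFinset,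
        Set.ncard_coe_finset]
    rw [← h2, ← h1, hW, Finset.card_filter]
    refine Finset.sum_congr rfl fun v _ => ?_
    have h3 := SimpleGraph.Subgraph.isMatching_iff_forall_degree.1 hM
    split_ifs with hv
    · rw [SimpleGraph.Subgraph.degree_spanningCoe]; exact (h3 v hv).symm
    · rw [SimpleGraph.Subgraph.degree_spanningCoe]
      exact (SimpleGraph.Subgraph.degree_of_notMem_verts hv).symm
  have hCc : C.ncard ≤ M.edgeSet.ncard := by
    have : C.encard ≤ M.edgeSet.encard := by rw [hC, h]; exact hMe
    exact ENat.toNat_le_toNat this (Set.encard_ne_top_iff.2 (Set.toFinite _))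
  have hCn : (C.toFinset)ᶜ.card + C.ncard = Fintype.card V := by
    rw [Set.ncard_eq_toFinset_card' C, Finset.card_compl_add_card]
  refine ⟨(C.toFinset)ᶜ, ?_, Finset.subset_univ _, fun A B hp => ?_⟩
  · have := SimpleGraph.isIndepSet_compl_iff_isVertexCover.2 hcov
    simpa [stableSets] using this
  -- The mate of a vertex of `A` cannot lie in `B`, and mates are distinct.
  · have hAB : (A ∩ W).card ≤ (W \ B).card := by
      have hpart : ∀ v ∈ A ∩ W, ∃ w, M.Adj v w := by
        intro v hv
        simp only [hW, Finset.mem_inter, Finset.mem_filter] at hv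
        exact (hM hv.2.2).exists
      choose! f hf using hpart
      refine Finset.card_le_card_of_injOn f ?_ ?_
      · intro v hv
        have := hf v hv
        have hv := Finset.mem_inter.1 hv
        simp only [Finset.coe_sdiff, Set.mem_sdiff, Finset.mem_coe, hW, Finset.mem_filter,
          Finset.mem_univ, true_and]
        exact ⟨this.snd_mem, fun hb => hp.not_adj v hv.1 _ hb this.adj_sub⟩
      · intro v hv w hw hvw
        exact hM.eq_of_adj_right (hf v hv) (hvw ▸ hf w hw)
    have h1 := Finset.card_sdiff_add_card_inter A W
    have h2 := Finset.card_sdiff_add_card_inter B W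
    have h3 := Finset.card_sdiff_add_card_inter W B
    have h4 : (A \ W).card ≤ Wᶜ.card := Finset.card_le_card fun x => by
      simp only [Finset.mem_sdiff, Finset.mem_compl]; tauto
    have h5 : (B \ W).card ≤ Wᶜ.card := Finset.card_le_card fun x => by
      simp only [Finset.mem_sdiff, Finset.mem_compl]; tauto
    have h6 := Finset.card_compl_add_card W
    rw [Finset.inter_comm] at h3
    omega

end Fintype

end StablePairs

/-! ### The robust value -/

section Value

variable {V : Type*} [Fintype V] {G : SimpleGraph V}

theorem le_worstCaseWeight {F : Set (Finset V)} {S : Finset V} {k : ℕ}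
    (h : ∀ f, ∃ e, IsRecourse F S f e ∧ k ≤ (secondStage S f e).card) :
    (k : ℝ≥0) ≤ worstCaseWeight F (fun _ => 1) S := by
  classical
  refine Finset.le_inf' _ _ fun f _ => ?_
  obtain ⟨e, he, hk⟩ := h f
  refine le_trans ?_ (Finset.le_sup (Finset.mem_filter.2 ⟨Finset.mem_univ e, he⟩))
  simpa using hk

theorem worstCaseWeight_le_of_forall {F : Set (Finset V)} {S : Finset V} {k : ℕ} (f : Option V)
    (h : ∀ e, IsRecourse F S f e → (secondStage S f e).card ≤ k) :
    worstCaseWeight F (fun _ => 1) S ≤ (k : ℝ≥0) := by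
  classical
  refine (Finset.inf'_le _ (Finset.mem_univ f)).trans ?_
  refine Finset.sup_le fun e he => ?_
  simpa using h e (Finset.mem_filter.1 he).2

theorem worstCaseWeight_le_card {S T : Finset V}
    (hT : ∀ S ∈ stableSets G, S.card ≤ T.card) :
    worstCaseWeight (stableSets G) (fun _ => 1) S ≤ (T.card : ℝ≥0) :=
  worstCaseWeight_le_of_forall none fun _ he => hT _ he.2

omit [Fintype V] in
theorem interdict_subset {S : Finset V} (f : Option V) : interdict S f ⊆ S := by
  classical
  cases f with
  | none => exact subset_rfl
  | some f => exact Finset.erase_subset _ _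

theorem card_sub_one_le_worstCaseWeight {S : Finset V} (hS : S ∈ stableSets G) :
    ((S.card - 1 : ℕ) : ℝ≥0) ≤ worstCaseWeight (stableSets G) (fun _ => 1) S := by
  classical
  refine le_worstCaseWeight fun f => ⟨none, ⟨by simp, mem_stableSets_of_subset
    (interdict_subset f) hS⟩, ?_⟩
  cases f with
  | none => simp [secondStage, interdict]
  | some f => simpa [secondStage, interdict] using Finset.pred_card_le_card_erase

/-- Every vertex of the stable set `S` is the only neighbour in `S` of some vertex. -/
def HasPrivateNeighbors (G : SimpleGraph V) (S : Finset V) : Prop :=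
  ∀ f ∈ S, ∃ e, G.Adj e f ∧ ∀ x ∈ S, G.Adj e x → x = f

theorem card_le_worstCaseWeight {S : Finset V} (hS : S ∈ stableSets G)
    (h : HasPrivateNeighbors G S) :
    (S.card : ℝ≥0) ≤ worstCaseWeight (stableSets G) (fun _ => 1) S := by
  classical
  have hS' := mem_stableSets_iff.1 hS
  refine le_worstCaseWeight fun f => ?_
  cases f with
  | none => exact ⟨none, ⟨by simp, hS⟩, le_rfl⟩
  | some f =>
    by_cases hf : f ∈ S
    · obtain ⟨e, hef, he⟩ := h f hf
      have heS : e ∉ S := fun hes => hS' e hes f hf hef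
      refine ⟨some e, ⟨?_, ?_⟩, ?_⟩
      · rintro x ⟨rfl⟩
        exact ⟨heS, fun h => hef.ne (Option.some_injective _ h).symm⟩
      · rw [mem_stableSets_iff]
        simp only [secondStage, interdict, Finset.mem_insert, Finset.mem_erase]
        rintro a (rfl | ha) b (rfl | hb) hab
        · exact hab.ne rfl
        · exact hb.1 (he b hb.2 hab)
        · exact ha.1 (he a ha.2 hab.symm)
        · exact hS' a ha.2 b hb.2 hab
      · simp only [secondStage, interdict]
        rw [Finset.card_insert_of_notMem (by simp [heS]), Finset.card_erase_add_one hf]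
    · refine ⟨none, ⟨by simp, ?_⟩, ?_⟩
      · simpa [secondStage, interdict, Finset.erase_eq_of_notMem hf] using hS
      · simp [secondStage, interdict, Finset.erase_eq_of_notMem hf]

/-- If some solution has the value of a maximum stable set, then some maximum stable set has private
neighbours. -/
theorem exists_hasPrivateNeighbors {S T : Finset V} (hS : S ∈ stableSets G)
    (hT : IsTight G Finset.univ T)
    (h : ¬ worstCaseWeight (stableSets G) (fun _ => 1) S ≤ ((T.card - 1 : ℕ) : ℝ≥0)) :
    ∃ R ∈ stableSets G, R.card = T.card ∧ HasPrivateNeighbors G R := by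
  classical
  have hmax : ∀ R ∈ stableSets G, R.card ≤ T.card := fun R hR => hT.card_le hR R.subset_univ
  have hrec : ∀ f, ∃ e, IsRecourse (stableSets G) S f e ∧ T.card ≤ (secondStage S f e).card := by
    intro f
    by_contra! hcon
    exact h (worstCaseWeight_le_of_forall f fun e he => by have := hcon e he; omega)
  have hS' := mem_stableSets_iff.1 hS
  -- The empty set can have value α = 1 without being maximum, because a vertex may be added even if
  -- none is removed. Then a singleton takes its place.
  rcases S.eq_empty_or_nonempty with rfl | ⟨f, hf⟩
  · rcases T.eq_empty_or_nonempty with rfl | ⟨v, hv⟩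
    · exact ⟨∅, hS, rfl, by simp [HasPrivateNeighbors]⟩
    · obtain ⟨e, he, hc⟩ := hrec (some v)
      have hpos : 0 < T.card := Finset.card_pos.2 ⟨v, hv⟩
      cases e with
      | none => simp [secondStage, interdict] at hc; simp [hc] at hv
      | some e =>
        have hev : v ≠ e := fun h => (he.1 e rfl).2 (by rw [h])
        have hT1 : T.card = 1 := by
          simp [secondStage, interdict] at hc; omega
        refine ⟨{v}, by rw [mem_stableSets_iff]; simp, by simp [hT1], ?_⟩
        intro f hf
        rw [Finset.mem_singleton] at hf
        subst hf
        refine ⟨e, ?_, by simp⟩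
        -- Otherwise `{e, f}` would be a stable set of size 2, but α = 1.
        by_contra hadj
        have := hmax {e, f} (by
          rw [mem_stableSets_iff]
          have : ¬ G.Adj f e := fun h => hadj h.symm
          simp [hadj, this])
        rw [Finset.card_pair hev.symm] at this
        omega
  · have main : ∀ f ∈ S, S.card = T.card ∧ ∃ e, e ∉ S ∧ e ≠ f ∧
        insert e (S.erase f) ∈ stableSets G := by
      intro f hf
      obtain ⟨e, he, hc⟩ := hrec (some f)
      have hle := hmax S hS
      have hpos := Finset.card_erase_add_one hf
      cases e with
      | none => simp only [secondStage, interdict] at hc; omega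
      | some e =>
        have h1 := he.1 e rfl
        have h2 := he.2
        simp only [secondStage, interdict] at hc h2
        rw [Finset.card_insert_of_notMem (by simp [h1.1])] at hc
        refine ⟨by omega, e, h1.1, fun h => h1.2 (by rw [h]), h2⟩
    refine ⟨S, hS, (main f hf).1, fun f hf => ?_⟩
    obtain ⟨hcard, e, heS, hef, hst⟩ := main f hf
    rw [mem_stableSets_iff] at hst
    have huniq : ∀ x ∈ S, G.Adj e x → x = f := by
      intro x hx hex
      by_contra hxf
      exact hst e (by simp) x (by simp [hx, hxf]) hex
    refine ⟨e, ?_, huniq⟩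
    -- A vertex `e` without neighbours in `S` would extend `S` beyond the maximum size.
    by_contra hadj
    have := hmax (insert e S) (by
      rw [mem_stableSets_iff]
      simp only [Finset.mem_insert]
      rintro a (rfl | ha) b (rfl | hb) hab
      · exact hab.ne rfl
      · exact hadj (huniq b hb hab ▸ hab)
      · exact hadj (huniq a ha hab.symm ▸ hab.symm)
      · exact hS' a ha b hb hab)
    rw [Finset.card_insert_of_notMem heS] at this
    omega

/-! ### Coronas and their leaf sets. -/

/-- `v` has exactly one neighbour. -/
def IsLeaf (G : SimpleGraph V) (v : V) : Prop := ∃! u, G.Adj v u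

/-- Every vertex is a leaf or has exactly one leaf as a neighbour. -/
def IsCorona (G : SimpleGraph V) : Prop :=
  ∀ v, IsLeaf G v ∨ ∃! u, G.Adj v u ∧ IsLeaf G u

/-- Choosing private neighbours gives an injection `g` from `T` into its complement, which is onto
because |V| ≤ 2|T|. A neighbour of `t ∈ T` is therefore some `g f`, whose only neighbour in `T` is
`f`. Thus `f = t`, and `t` is a leaf. -/
theorem isCorona_of_hasPrivateNeighbors {T : Finset V} (hT : IsTight G Finset.univ T)
    (hp : HasPrivateNeighbors G T) : IsCorona G := by
  classical
  have hTs := mem_stableSets_iff.1 hT.stable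
  choose! g hg hg' using hp
  -- Tightness applied to the stable pair (V, ∅).
  have hcard : Fintype.card V ≤ 2 * T.card := by
    have := hT.le Finset.univ ∅ ⟨subset_rfl, by simp, by simp⟩
    simpa using this
  have hgT : T.image g = Tᶜ := by
    refine Finset.eq_of_subset_of_card_le ?_ ?_
    · intro x hx
      obtain ⟨f, hf, rfl⟩ := Finset.mem_image.1 hx
      exact Finset.mem_compl.2 fun h => hTs _ h f hf (hg f hf)
    · have hinj : Set.InjOn g T := by
        intro a ha b hb hab
        exact hg' b hb a ha (hab ▸ hg a ha)
      rw [Finset.card_image_of_injOn hinj, Finset.card_compl]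
      omega
  have hleaf : ∀ t ∈ T, IsLeaf G t := by
    intro t ht
    refine ⟨g t, (hg t ht).symm, fun y hy => ?_⟩
    have hyT : y ∈ Tᶜ := Finset.mem_compl.2 fun h => hTs t ht y h hy
    rw [← hgT] at hyT
    obtain ⟨f, hf, rfl⟩ := Finset.mem_image.1 hyT
    rw [hg' f hf t ht hy.symm]
  intro v
  by_cases hvT : v ∈ T
  · exact .inl (hleaf v hvT)
  · by_cases hvl : IsLeaf G v
    · exact .inl hvl
    · right
      have : v ∈ T.image g := by rw [hgT]; simpa using hvT
      obtain ⟨f, hf, rfl⟩ := Finset.mem_image.1 this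
      refine ⟨f, ⟨hg f hf, hleaf f hf⟩, ?_⟩
      rintro y ⟨hy, hyl⟩
      by_cases hyT : y ∈ T
      · exact hg' f hf y hyT hy
      · have : y ∈ T.image g := by rw [hgT]; simpa using hyT
        obtain ⟨x, hx, rfl⟩ := Finset.mem_image.1 this
        have := hyl.unique hy.symm (hg x hx)
        exact absurd (this ▸ hx) hvT

open Classical in
/-- The leaves of `G`, with only the smaller vertex of every component that is an edge. -/
noncomputable def leafSet [LinearOrder V] (G : SimpleGraph V) : Finset V :=
  Finset.univ.filter fun v => IsLeaf G v ∧ ∃ u, G.Adj v u ∧ (IsLeaf G u → v < u)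

theorem mem_leafSet [LinearOrder V] {v : V} :
    v ∈ leafSet G ↔ IsLeaf G v ∧ ∃ u, G.Adj v u ∧ (IsLeaf G u → v < u) := by
  simp [leafSet]

theorem leafSet_mem_stableSets [LinearOrder V] : leafSet G ∈ stableSets G := by
  rw [mem_stableSets_iff]
  intro a ha b hb hab
  obtain ⟨hla, u, hau, hu⟩ := mem_leafSet.1 ha
  obtain ⟨hlb, w, hbw, hw⟩ := mem_leafSet.1 hb
  obtain rfl := hla.unique hab hau
  obtain rfl := hlb.unique hab.symm hbw
  exact lt_asymm (hu hlb) (hw hla)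

/-- The set of chosen leaves is dominating: a leaf that was not chosen is the larger end of a
component that is an edge, and any other vertex is adjacent to a leaf, which was chosen. -/
theorem IsCorona.exists_leaf [LinearOrder V] (h : IsCorona G) {t : V} (ht : t ∉ leafSet G) :
    ∃ x ∈ leafSet G, G.Adj x t := by
  rcases h t with hl | ⟨x, ⟨htx, hx⟩, -⟩
  · have hl' := hl
    obtain ⟨u, htu, hu⟩ := hl'
    have hn : IsLeaf G u ∧ ¬ t < u := by
      by_contra hcon
      refine ht (mem_leafSet.2 ⟨hl, u, htu, ?_⟩)
      tauto
    exact ⟨u, mem_leafSet.2 ⟨hn.1, t, htu.symm, fun _ =>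
      lt_of_le_of_ne (not_lt.1 hn.2) htu.ne'⟩, htu.symm⟩
  · by_cases hl : IsLeaf G t
    · have hlt : ¬ t < x := fun hlt => ht (mem_leafSet.2 ⟨hl, x, htx, fun _ => hlt⟩)
      exact ⟨x, mem_leafSet.2 ⟨hx, t, htx.symm, fun _ =>
        lt_of_le_of_ne (not_lt.1 hlt) htx.ne'⟩, htx.symm⟩
    · exact ⟨x, mem_leafSet.2 ⟨hx, t, htx.symm, fun h => absurd h hl⟩, htx.symm⟩

/-- The closed neighbourhoods of the chosen leaves are edges that cover all vertices, and a stable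
set has at most one vertex in each of them. -/
theorem IsCorona.card_le [LinearOrder V] (h : IsCorona G) {T : Finset V}
    (hT : T ∈ stableSets G) : T.card ≤ (leafSet G).card := by
  classical
  rw [mem_stableSets_iff] at hT
  have : ∀ t, ∃ x ∈ leafSet G, (t ∈ leafSet G ∧ x = t) ∨ G.Adj x t := by
    intro t
    by_cases ht : t ∈ leafSet G
    · exact ⟨t, ht, .inl ⟨ht, rfl⟩⟩
    · obtain ⟨x, hx, hxt⟩ := h.exists_leaf ht
      exact ⟨x, hx, .inr hxt⟩
  choose g hg hg' using this
  refine Finset.card_le_card_of_injOn g (fun t _ => hg t) ?_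
  intro a ha b hb hab
  rcases hg' a with ⟨-, h1⟩ | h1 <;> rcases hg' b with ⟨-, h2⟩ | h2
  · rw [← h1, ← h2, hab]
  · rw [← hab, h1] at h2; exact absurd h2 (hT a ha b hb)
  · rw [hab, h2] at h1; exact absurd h1 (hT b hb a ha)
  · rw [← hab] at h2
    exact (mem_leafSet.1 (hg a)).1.unique h1 h2

/-- The private neighbour of a leaf is its only neighbour `u`. Either `u` is itself a leaf, or it
has just one leaf next to it. -/
theorem IsCorona.hasPrivateNeighbors [LinearOrder V] (h : IsCorona G) :
    HasPrivateNeighbors G (leafSet G) := by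
  intro f hf
  obtain ⟨hl, u, hfu, hu⟩ := mem_leafSet.1 hf
  refine ⟨u, hfu.symm, fun x hx hux => ?_⟩
  rcases h u with hul | ⟨y, -, hy⟩
  · exact hul.unique hux hfu.symm
  · rw [hy x ⟨hux, (mem_leafSet.1 hx).1⟩, hy f ⟨hfu.symm, hl⟩]

/-- The leaves form an optimal solution if `G` is a corona. -/
theorem IsCorona.isRobustOptimal [LinearOrder V] (h : IsCorona G) :
    IsRobustOptimal (stableSets G) (fun _ => 1) (leafSet G) ∧
      ((leafSet G).card : ℝ≥0) = worstCaseWeight (stableSets G) (fun _ => 1) (leafSet G) := by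
  have h1 := card_le_worstCaseWeight leafSet_mem_stableSets h.hasPrivateNeighbors
  have h2 : ∀ S, worstCaseWeight (stableSets G) (fun _ => 1) S ≤ ((leafSet G).card : ℝ≥0) :=
    fun S => worstCaseWeight_le_card fun S hS => h.card_le hS
  exact ⟨⟨leafSet_mem_stableSets, fun T _ => (h2 T).trans h1⟩, h1.antisymm (h2 _)⟩

/-- If `G` is not a corona, then every maximum stable set is an optimal solution. -/
theorem isRobustOptimal_of_not_isCorona {S T : Finset V} (hT : IsTight G Finset.univ T)
    (hc : ¬ IsCorona G) (hS : S ∈ stableSets G) (hcard : S.card = T.card) :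
    IsRobustOptimal (stableSets G) (fun _ => 1) S ∧
      ((S.card - 1 : ℕ) : ℝ≥0) = worstCaseWeight (stableSets G) (fun _ => 1) S := by
  have h1 := card_sub_one_le_worstCaseWeight hS
  have h2 : ∀ R ∈ stableSets G,
      worstCaseWeight (stableSets G) (fun _ => 1) R ≤ ((S.card - 1 : ℕ) : ℝ≥0) := by
    intro R hR
    by_contra hcon
    rw [hcard] at hcon
    obtain ⟨Q, hQ, hQc, hQp⟩ := exists_hasPrivateNeighbors hR hT hcon
    exact hc (isCorona_of_hasPrivateNeighbors
      ⟨hQ, Q.subset_univ, fun A B h => hQc ▸ hT.le A B h⟩ hQp)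
  exact ⟨⟨hS, fun R hR => (h2 R hR).trans h1⟩, h1.antisymm (h2 S hS)⟩

end Value

/-! ### The auction algorithm for stable pairs -/

open Classical in
/-- Optimality certificate of the auction algorithm. In the bipartite double cover, the right vertex
`w` of positive price `p w` is matched to the left vertex `o w`. -/
theorem isStablePairNumber_of_prices {V : Type*} {G : SimpleGraph V} {H : Finset V} {n : ℕ}
    (hH : H.card ≤ n) (p : V → ℕ) (o : V → V)
    (hadj : ∀ w ∈ H, 0 < p w → o w ∈ H ∧ G.Adj (o w) w)
    (hinj : ∀ w ∈ H, ∀ w' ∈ H, 0 < p w → 0 < p w' → o w = o w' → w = w')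
    (hdone : ∀ u ∈ H, ∀ w ∈ H, G.Adj u w → p w < n →
      ∃ v ∈ H, 0 < p v ∧ o v = u ∧ p v ≤ p w + 1) :
    IsStablePairNumber G H (H.card + (H.filter fun w => p w = 0).card) := by
  constructor
  -- At most `n` prices occur among the `n + 1` values `0, …, n`, so some value `k` is not a price.
  · obtain ⟨k, hk, hkH⟩ : ∃ k ∈ Finset.range (n + 1), k ∉ H.image p :=
      Finset.exists_mem_notMem_of_card_lt_card (by
        have := Finset.card_image_le (s := H) (f := p)
        simp only [Finset.card_range]; omega)
    have hk' : ∀ w ∈ H, p w ≠ k := fun w hw h => hkH (Finset.mem_image.2 ⟨w, hw, h⟩)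
    rw [Finset.mem_range] at hk
    set Q := H.filter fun w => 0 < p w ∧ p w < k with hQ
    -- Cut at the gap `k`: a left vertex with a neighbour cheaper than `k` owns a vertex of price at
    -- most `k`, hence below `k`, and so was removed from the left side.
    refine ⟨H \ Q.image o, H.filter fun w => p w < k, ⟨Finset.sdiff_subset,
      Finset.filter_subset _ _, ?_⟩, ?_⟩
    · intro u hu w hw huw
      rw [Finset.mem_sdiff] at hu
      rw [Finset.mem_filter] at hw
      obtain ⟨v, hv, hv0, rfl, hvw⟩ := hdone u hu.1 w hw.1 huw (by omega)
      refine hu.2 (Finset.mem_image_of_mem o (Finset.mem_filter.2 ⟨hv, hv0, ?_⟩))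
      have := hk' v hv
      omega
    · have h1 : (Q.image o).card ≤ Q.card := Finset.card_image_le
      have h2 := Finset.le_card_sdiff (Q.image o) H
      have h3 : (H.filter fun w => p w = 0).card + Q.card
          ≤ (H.filter fun w => p w < k).card := by
        rw [← Finset.card_union_of_disjoint]
        · refine Finset.card_le_card fun w hw => ?_
          simp only [hQ, Finset.mem_union, Finset.mem_filter] at hw ⊢
          rcases hw with hw | hw
          · have := hk' w hw.1
            exact ⟨hw.1, by omega⟩
          · exact ⟨hw.1, hw.2.2⟩
        · rw [Finset.disjoint_left]
          intro w hw hw'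
          simp only [hQ, Finset.mem_filter] at hw hw'
          omega
      have h4 : Q.card ≤ H.card := Finset.card_filter_le _ _
      omega
  · intro A B h
    -- Weak duality: the owners of the positively priced vertices of `B` are distinct and avoid `A`.
    set Q := B.filter fun w => 0 < p w with hQ
    have h1 : Q.card ≤ (H \ A).card := by
      refine Finset.card_le_card_of_injOn o ?_ ?_
      · intro w hw
        have hw := Finset.mem_filter.1 hw
        have := hadj w (h.right_subset hw.1) hw.2
        rw [Finset.mem_coe, Finset.mem_sdiff]
        exact ⟨this.1, fun hA => h.not_adj _ hA w hw.1 this.2⟩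
      · intro w hw w' hw' he
        have hw := Finset.mem_filter.1 hw
        have hw' := Finset.mem_filter.1 hw'
        exact hinj w (h.right_subset hw.1) w' (h.right_subset hw'.1) hw.2 hw'.2 he
    have h2 := Finset.card_sdiff_add_card_eq_card h.left_subset
    have h3 : B.card ≤ Q.card + (H.filter fun w => p w = 0).card := by
      refine (Finset.card_le_card ?_).trans (Finset.card_union_le _ _)
      intro w hw
      simp only [hQ, Finset.mem_union, Finset.mem_filter]
      have := h.right_subset hw
      rcases Nat.eq_zero_or_pos (p w) with h | h
      · exact .inr ⟨this, h⟩
      · exact .inl ⟨hw, h⟩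
    omega

/-- The invariant of the auction: prices `p`, owners `o` (shifted by one, `0` for none) of the right
vertices, and mates `m` of the left vertices (vertices and mates shifted by one, `0` for none), for
the edge relation `E` on `{0, …, n - 1}`. -/
structure AuctionInv (n : ℕ) (E : ℕ → ℕ → Prop) (p o m : ℕ → ℕ) : Prop where
  price_le : ∀ w < n, p w ≤ n
  owner : ∀ w < n, 0 < p w → ∃ u < n, o w = u + 1 ∧ m (u + 1) = w + 1 ∧ E u w
  unowned : ∀ w < n, p w = 0 → o w = 0
  mate : ∀ u < n, m (u + 1) ≠ 0 → ∃ w < n, m (u + 1) = w + 1 ∧ o w = u + 1 ∧ 0 < p w ∧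
    ∀ w' < n, E u w' → p w ≤ p w' + 1

/-- A bid of the unmatched left vertex `u` for a cheapest neighbour `w` keeps the invariant. -/
theorem AuctionInv.bid {n : ℕ} {E : ℕ → ℕ → Prop} {p o m : ℕ → ℕ} (h : AuctionInv n E p o m)
    {u w : ℕ} (hu : u < n) (hw : w < n) (hE : E u w) (hm : m (u + 1) = 0) (hp : p w < n)
    (hmin : ∀ w' < n, E u w' → p w ≤ p w') :
    AuctionInv n E (Function.update p w (p w + 1)) (Function.update o w (u + 1))
      (Function.update (Function.update m (o w) 0) (u + 1) (w + 1)) := by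
  have hmono : ∀ x, p x ≤ Function.update p w (p w + 1) x := by
    intro x
    by_cases hx : x = w
    · subst hx; simp
    · simp [hx]
  constructor
  · intro x hx
    by_cases hxw : x = w
    · subst hxw; simpa using hp
    · simpa [hxw] using h.price_le x hx
  · intro x hx hpx
    by_cases hxw : x = w
    · subst hxw; exact ⟨u, hu, by simp, by simp, hE⟩
    · simp only [Function.update_of_ne hxw] at hpx ⊢
      obtain ⟨v, hv, hov, hmv, hEv⟩ := h.owner x hx hpx
      have hvu : v ≠ u := by rintro rfl; omega
      refine ⟨v, hv, hov, ?_, hEv⟩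
      rw [Function.update_of_ne (by omega), Function.update_of_ne, hmv]
      intro hvo
      -- If the cleared mate were that of `v`, then `v` would own `w`, and its mate would be `w`
      -- instead of `x`.
      rcases Nat.eq_zero_or_pos (p w) with h0 | h0
      · have := h.unowned w hw h0; omega
      · obtain ⟨y, _, hoy, hmy, _⟩ := h.owner w hw h0
        rw [hvo, hoy, hmy] at hmv
        omega
  · intro x hx hpx
    by_cases hxw : x = w
    · subst hxw; simp at hpx
    · simp only [Function.update_of_ne hxw] at hpx ⊢
      exact h.unowned x hx hpx
  · intro v hv hmv
    by_cases hvu : v = u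
    · subst hvu
      -- The slack 1 pays for the raise: `w` was a cheapest neighbour before its price grew by 1.
      refine ⟨w, hw, by simp, by simp, by simp, fun w' hw' hEw' => ?_⟩
      have := hmin w' hw' hEw'
      have := hmono w'
      simp only [Function.update_self]
      omega
    · have hne : v + 1 ≠ u + 1 := by omega
      rw [Function.update_of_ne hne] at hmv ⊢
      by_cases hvo : v + 1 = o w
      · rw [hvo] at hmv; simp at hmv
      · rw [Function.update_of_ne hvo] at hmv ⊢
        obtain ⟨x, hx, hmx, hox, hpx, hx'⟩ := h.mate v hv hmv
        have hxw : x ≠ w := by rintro rfl; exact hvo hox.symm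
        refine ⟨x, hx, hmx, by rw [Function.update_of_ne hxw, hox],
          by rwa [Function.update_of_ne hxw], fun w' hw' hEw' => ?_⟩
        have := hx' w' hw' hEw'
        have := hmono w'
        rw [Function.update_of_ne hxw]
        omega

/-- The left vertex `u` is matched, or all its neighbours have become too expensive. -/
def Served (n : ℕ) (E : ℕ → ℕ → Prop) (p m : ℕ → ℕ) (u : ℕ) : Prop :=
  m (u + 1) ≠ 0 ∨ ∀ w < n, E u w → n ≤ p w

/-! ### Programs for the auction -/

/-- The entry of the adjacency matrix at the row in register `u` and the column in register `v`. -/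
def adjExpr (u v : ℕ) : Expr := .cell 0 (.add (.cell 2 (.reg u)) (.reg v))

/-- Adjacency between two vertices of the set in array `3`. -/
def maskedAdjExpr (u v : ℕ) : Expr :=
  .and (.cell 3 (.reg u)) (.and (.cell 3 (.reg v)) (adjExpr u v))

/-- The vertex in register `1` gets the vertex in register `3`. -/
def bidProgram : ForProgram :=
  .seq (.store 6 (.cell 5 (.reg 3)) (.const 0))
    (.seq (.store 5 (.reg 3) (.add (.reg 1) (.const 1)))
      (.seq (.store 6 (.add (.reg 1) (.const 1)) (.add (.reg 3) (.const 1)))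
        (.store 4 (.reg 3) (.add (.cell 4 (.reg 3)) (.const 1)))))

/-- Condition for a bid of the vertex in register `1` for the vertex in register `3` at the price in
register `2`. -/
def bidExpr : Expr :=
  .and (.eq (.cell 6 (.add (.reg 1) (.const 1))) (.const 0))
    (.and (maskedAdjExpr 1 3) (.eq (.cell 4 (.reg 3)) (.reg 2)))

/-- Try the bids of the vertex in register `1` for all vertices at the price in register `2`. -/
def levelProgram : ForProgram := .loop 3 0 (.when bidExpr bidProgram)

/-- Serve the vertex in register `1`. -/
def serveProgram : ForProgram := .loop 2 0 levelProgram

/-- One round of the auction. -/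
def roundProgram : ForProgram := .loop 1 0 serveProgram

/-- The auction on the subgraph induced by the set in array `3`. The maximum size of a stable pair
is put into register `7`. -/
def auctionProgram : ForProgram :=
  .seq (.tabulate 4 0 .skip (.const 0))
    (.seq (.tabulate 5 0 .skip (.const 0))
      (.seq (.tabulate 6 1 .skip (.const 0))
        (.seq (.loop 4 1 (.loop 5 1 roundProgram))
          (.seq (.count 1 10 (.cell 3 (.reg 1)))
            (.seq (.count 1 11 (.and (.cell 3 (.reg 1)) (.eq (.cell 4 (.reg 1)) (.const 0))))
              (.assign 7 (.add (.reg 10) (.reg 11))))))))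

/-- The edge relation of the subgraph induced by the set in array `3`. -/
def maskedAdj (s : State) (u v : ℕ) : Prop :=
  s.arr 3 u ≠ 0 ∧ s.arr 3 v ≠ 0 ∧ s.arr 0 (s.arr 2 u + v) ≠ 0

theorem eval_maskedAdjExpr (s : State) (u v : ℕ) :
    (maskedAdjExpr u v).eval s ≠ 0 ↔ maskedAdj s (s.reg u) (s.reg v) := by
  rw [maskedAdjExpr, Expr.eval_and, Expr.eval_and]
  simp [Expr.eval, maskedAdj, adjExpr]

theorem maskedAdj_congr {s s' : State} (h0 : s'.arr 0 = s.arr 0) (h2 : s'.arr 2 = s.arr 2)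
    (h3 : s'.arr 3 = s.arr 3) : maskedAdj s' = maskedAdj s := by
  funext u v
  simp [maskedAdj, h0, h2, h3]

/-- Total price. -/
def priceSum (n : ℕ) (s : State) : ℕ := ∑ w ∈ Finset.range n, s.arr 4 w

/-- The state of the auction is the same in both states. -/
structure SameAuction (s s' : State) : Prop where
  price : s'.arr 4 = s.arr 4
  owner : s'.arr 5 = s.arr 5
  mate : s'.arr 6 = s.arr 6

/-- The invariant of the auction in a state. -/
def State.AuctionInv (n : ℕ) (E : ℕ → ℕ → Prop) (s : State) : Prop :=
  RecoverableRobust.AuctionInv n E (s.arr 4) (s.arr 5) (s.arr 6)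

/-- The vertex `u` is served in the state `s`. -/
def State.Served (n : ℕ) (E : ℕ → ℕ → Prop) (s : State) (u : ℕ) : Prop :=
  RecoverableRobust.Served n E (s.arr 4) (s.arr 6) u

/-- Some vertex is not served in the state `s`, and the prices have grown in `s'`. -/
def Raised (n : ℕ) (E : ℕ → ℕ → Prop) (s s' : State) : Prop :=
  priceSum n s < priceSum n s' ∧ ∃ u < n, ¬ s.Served n E u

/-- Nothing has happened, or progress has been made. -/
def Progress (n : ℕ) (E : ℕ → ℕ → Prop) (s s' : State) : Prop :=
  SameAuction s s' ∨ Raised n E s s'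

theorem SameAuction.trans {s s' s'' : State} (h : SameAuction s s') (h' : SameAuction s' s'') :
    SameAuction s s'' :=
  ⟨h'.price.trans h.price, h'.owner.trans h.owner, h'.mate.trans h.mate⟩

section Congr

variable {n : ℕ} {E : ℕ → ℕ → Prop} {s s' s'' : State}

theorem SameAuction.served_iff (h : SameAuction s s') {u : ℕ} :
    s'.Served n E u ↔ s.Served n E u := by
  simp only [State.Served, h.price, h.mate]

theorem SameAuction.priceSum_eq (h : SameAuction s s') : priceSum n s' = priceSum n s := by
  simp only [priceSum, h.price]

theorem Progress.priceSum_le (h : Progress n E s s') : priceSum n s ≤ priceSum n s' := by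
  rcases h with h | h
  · exact h.priceSum_eq.ge
  · exact h.1.le

theorem Raised.trans_progress (h : Raised n E s s') (h' : Progress n E s' s'') :
    Raised n E s s'' :=
  ⟨h.1.trans_le h'.priceSum_le, h.2⟩

theorem SameAuction.trans_raised (h : SameAuction s s') (h' : Raised n E s' s'') :
    Raised n E s s'' := by
  obtain ⟨h1, u, hu, h2⟩ := h'
  exact ⟨h.priceSum_eq (n := n) ▸ h1, u, hu, fun h3 => h2 (h.served_iff.2 h3)⟩

theorem Progress.trans (h : Progress n E s s') (h' : Progress n E s' s'') :
    Progress n E s s'' := by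
  rcases h with h | h
  · rcases h' with h' | h'
    · exact .inl (h.trans h')
    · exact .inr (h.trans_raised h')
  · exact .inr (h.trans_progress h')

end Congr

/-- The shift by one matters here: if the vertex bid for has no owner, the first store hits the
dummy cell `0` of array `6`. -/
theorem den_bidProgram {n : ℕ} {E : ℕ → ℕ → Prop} {s : State} (h : s.AuctionInv n E)
    (hu : s.reg 1 < n) (hw : s.reg 3 < n) (hE : E (s.reg 1) (s.reg 3))
    (hm : s.arr 6 (s.reg 1 + 1) = 0) (hp : s.arr 4 (s.reg 3) < n)
    (hmin : ∀ w' < n, E (s.reg 1) w' → s.arr 4 (s.reg 3) ≤ s.arr 4 w') :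
    (bidProgram.den s).AuctionInv n E ∧ (bidProgram.den s).arr 6 (s.reg 1 + 1) ≠ 0 ∧
      Raised n E s (bidProgram.den s) := by
  have h4 : (bidProgram.den s).arr 4
      = Function.update (s.arr 4) (s.reg 3) (s.arr 4 (s.reg 3) + 1) := by
    simp [bidProgram, ForProgram.den, Expr.eval]
  have h5 : (bidProgram.den s).arr 5 = Function.update (s.arr 5) (s.reg 3) (s.reg 1 + 1) := by
    simp [bidProgram, ForProgram.den, Expr.eval]
  have h6 : (bidProgram.den s).arr 6 = Function.update (Function.update (s.arr 6)
      (s.arr 5 (s.reg 3)) 0) (s.reg 1 + 1) (s.reg 3 + 1) := by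
    simp [bidProgram, ForProgram.den, Expr.eval]
  refine ⟨?_, by simp [h6], ?_, s.reg 1, hu, ?_⟩
  · rw [State.AuctionInv, h4, h5, h6]
    exact AuctionInv.bid h hu hw hE hm hp hmin
  · rw [priceSum, priceSum, h4]
    refine Finset.sum_lt_sum (fun w _ => ?_) ⟨s.reg 3, Finset.mem_range.2 hw, by simp⟩
    by_cases hw : w = s.reg 3
    · subst hw; simp
    · simp [hw]
  · rintro (h | h)
    · exact h hm
    · have := h _ hw hE
      omega

/-- Levels are scanned upwards. While the bidder is unmatched, all its neighbours cost at least `k`,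
and those already scanned at level `k` cost more; so the first neighbour found at price `k` is a
cheapest one. -/
theorem den_levelProgram {n k : ℕ} {E : ℕ → ℕ → Prop} {s : State} (hn : s.reg 0 = n)
    (hE : E = maskedAdj s) (h : s.AuctionInv n E) (hu : s.reg 1 < n) (hk : s.reg 2 = k)
    (hkn : k < n)
    (hlow : s.arr 6 (s.reg 1 + 1) ≠ 0 ∨ ∀ w < n, E (s.reg 1) w → k ≤ s.arr 4 w) :
    (levelProgram.den s).AuctionInv n E ∧ Progress n E s (levelProgram.den s) ∧
      ((levelProgram.den s).arr 6 (s.reg 1 + 1) ≠ 0 ∨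
        ∀ w < n, E (s.reg 1) w → k + 1 ≤ (levelProgram.den s).arr 4 w) := by
  have key := ForProgram.loop_induction (p := .when bidExpr bidProgram) (x := 3) (c := 0) (s := s)
    (n := n) (fun i s' => s'.AuctionInv n E ∧ Progress n E s s' ∧
      (s'.arr 6 (s.reg 1 + 1) ≠ 0 ∨ ∀ w < n, E (s.reg 1) w → k ≤ s'.arr 4 w ∧
        (w < i → k + 1 ≤ s'.arr 4 w))) rfl hn ?_ ?_
  · obtain ⟨h1, h2, h3⟩ := key
    exact ⟨h1, h2, h3.imp id fun h w hw hEw => (h w hw hEw).2 hw⟩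
  · exact ⟨h, .inl ⟨rfl, rfl, rfl⟩, hlow.imp id fun h w hw hEw => ⟨h w hw hEw, by omega⟩⟩
  · rintro i s' hi h3 h0 hreg harr ⟨hI, hP, hL⟩
    have h1 : s'.reg 1 = s.reg 1 := hreg 1 (by decide) rfl
    have h2 : s'.reg 2 = k := (hreg 2 (by decide) rfl).trans hk
    have hE' : E = maskedAdj s' := hE.trans
      (maskedAdj_congr (harr 0 rfl) (harr 2 rfl) (harr 3 rfl)).symm
    have hc : bidExpr.eval s' ≠ 0 ↔
        s'.arr 6 (s.reg 1 + 1) = 0 ∧ E (s.reg 1) i ∧ s'.arr 4 i = k := by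
      rw [bidExpr, Expr.eval_and, Expr.eval_and, Expr.eval_eq, Expr.eval_eq, eval_maskedAdjExpr,
        ← hE', h1, h3]
      simp [Expr.eval, h1, h2, h3]
    simp only [ForProgram.when, ForProgram.den]
    split_ifs with hcond
    · obtain ⟨hm, hEi, hki⟩ := hc.1 hcond
      have hL' := hL.resolve_left (not_not.2 hm)
      have hb := den_bidProgram hI (by omega) (by omega) (by rwa [h1, h3]) (by rwa [h1])
        (by rw [h3]; omega) (by
          rw [h1, h3, hki]
          exact fun w hw hEw => (hL' w hw hEw).1)
      rw [h1] at hb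
      exact ⟨hb.1, hP.trans (.inr hb.2.2), .inl hb.2.1⟩
    · refine ⟨hI, hP.trans (.inl ⟨rfl, rfl, rfl⟩), ?_⟩
      by_cases hm : s'.arr 6 (s.reg 1 + 1) = 0
      · have hL' := hL.resolve_left (not_not.2 hm)
        refine .inr fun w hw hEw => ⟨(hL' w hw hEw).1, fun hwi => ?_⟩
        have h4 := hL' w hw hEw
        rcases Nat.lt_succ_iff_lt_or_eq.1 hwi with h5 | rfl
        · exact h4.2 h5
        · have : s'.arr 4 w ≠ k := fun h5 => hcond (hc.2 ⟨hm, hEw, h5⟩)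
          have := h4.1
          simp only [State.setReg_arr]
          omega
      · exact .inl hm

theorem den_serveProgram {n : ℕ} {E : ℕ → ℕ → Prop} {s : State} (hn : s.reg 0 = n)
    (hE : E = maskedAdj s) (h : s.AuctionInv n E) (hu : s.reg 1 < n) :
    (serveProgram.den s).AuctionInv n E ∧ Progress n E s (serveProgram.den s) ∧
      (serveProgram.den s).Served n E (s.reg 1) := by
  refine ForProgram.loop_induction (p := levelProgram) (x := 2) (c := 0) (s := s)
    (n := n) (fun k s' => s'.AuctionInv n E ∧ Progress n E s s' ∧
      (s'.arr 6 (s.reg 1 + 1) ≠ 0 ∨ ∀ w < n, E (s.reg 1) w → k ≤ s'.arr 4 w)) rfl hn ?_ ?_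
  · exact ⟨h, .inl ⟨rfl, rfl, rfl⟩, .inr fun w _ _ => Nat.zero_le _⟩
  · rintro k s' hk h2 h0 hreg harr ⟨hI, hP, hL⟩
    have h1 : s'.reg 1 = s.reg 1 := hreg 1 (by decide) rfl
    have hE' : E = maskedAdj s' := hE.trans
      (maskedAdj_congr (harr 0 rfl) (harr 2 rfl) (harr 3 rfl)).symm
    obtain ⟨k1, k2, k3⟩ := den_levelProgram h0 hE' hI (by omega) h2 hk (by rwa [h1])
    rw [h1] at k3
    exact ⟨k1, (hP.trans k2).trans (.inl ⟨rfl, rfl, rfl⟩), k3⟩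

/-- If no price changes during the round, each vertex was found served in the unchanged state, so
all of them are served. -/
theorem den_roundProgram {n : ℕ} {E : ℕ → ℕ → Prop} {s : State} (hn : s.reg 0 = n)
    (hE : E = maskedAdj s) (h : s.AuctionInv n E) :
    (roundProgram.den s).AuctionInv n E ∧
      (SameAuction s (roundProgram.den s) ∧ (∀ u < n, s.Served n E u) ∨
        Raised n E s (roundProgram.den s)) := by
  refine ForProgram.loop_induction (p := serveProgram) (x := 1) (c := 0) (s := s)
    (n := n) (fun i s' => s'.AuctionInv n E ∧
      (SameAuction s s' ∧ (∀ u < i, s.Served n E u) ∨ Raised n E s s')) rfl hn ?_ ?_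
  · exact ⟨h, .inl ⟨⟨rfl, rfl, rfl⟩, by omega⟩⟩
  · rintro i s' hi h1 h0 hreg harr ⟨hI, hP⟩
    have hE' : E = maskedAdj s' := hE.trans
      (maskedAdj_congr (harr 0 rfl) (harr 2 rfl) (harr 3 rfl)).symm
    obtain ⟨k1, k2, k3⟩ := den_serveProgram h0 hE' hI (by omega)
    rw [h1] at k3
    refine ⟨k1, ?_⟩
    rcases hP with ⟨hS, hP⟩ | hP
    · rcases k2 with k2 | k2
      · refine .inl ⟨(hS.trans k2).trans ⟨rfl, rfl, rfl⟩, fun u hu => ?_⟩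
        rcases Nat.lt_succ_iff_lt_or_eq.1 hu with h5 | rfl
        · exact hP u h5
        · exact (hS.trans k2).served_iff.1 k3
      · exact .inr (hS.trans_raised k2)
    · exact .inr (hP.trans_progress (k2.trans (.inl ⟨rfl, rfl, rfl⟩)))

/-- Each round before the end raises the total price, which never exceeds `n * n`; so `(n + 1) * (n
+ 1)` rounds suffice. -/
theorem den_rounds {n : ℕ} {E : ℕ → ℕ → Prop} {s : State} (hn : s.reg 0 = n)
    (hE : E = maskedAdj s) (h : s.AuctionInv n E) :
    ((ForProgram.loop 4 1 (.loop 5 1 roundProgram)).den s).AuctionInv n E ∧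
      ∀ u < n, ((ForProgram.loop 4 1 (.loop 5 1 roundProgram)).den s).Served n E u := by
  -- Once all vertices are served this remains so, because `Raised` requires an unserved vertex.
  have step : ∀ (j : ℕ) (s' : State), s'.reg 0 = n → E = maskedAdj s' →
      (s'.AuctionInv n E ∧ ((∀ u < n, s'.Served n E u) ∨ j ≤ priceSum n s')) →
      (roundProgram.den s').AuctionInv n E ∧ ((∀ u < n, (roundProgram.den s').Served n E u) ∨
        j + 1 ≤ priceSum n (roundProgram.den s')) := by
    rintro j s' h0 hE' ⟨hI, hP⟩
    obtain ⟨k1, k2⟩ := den_roundProgram h0 hE' hI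
    refine ⟨k1, ?_⟩
    rcases k2 with ⟨k2, k3⟩ | ⟨k2, u, hu, hus⟩
    · exact .inl fun u hu => k2.served_iff.2 (k3 u hu)
    · rcases hP with hP | hP
      · exact absurd (hP u hu) hus
      · exact .inr (by omega)
  have key := ForProgram.loop_induction (p := .loop 5 1 roundProgram) (x := 4) (c := 1) (s := s)
    (n := n) (fun i s' => s'.AuctionInv n E ∧
      ((∀ u < n, s'.Served n E u) ∨ i * (n + 1) ≤ priceSum n s')) rfl hn ?_ ?_
  · refine ⟨key.1, key.2.resolve_right fun hbig => ?_⟩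
    have hle : priceSum n ((ForProgram.loop 4 1 (.loop 5 1 roundProgram)).den s) ≤ n * n := by
      have := Finset.sum_le_card_nsmul (Finset.range n)
        (((ForProgram.loop 4 1 (.loop 5 1 roundProgram)).den s).arr 4) n
        fun w hw => key.1.price_le w (Finset.mem_range.1 hw)
      simpa [priceSum] using this
    nlinarith
  · exact ⟨h, .inr (by simp)⟩
  · rintro i s' hi h4 h0 hreg harr hI
    have hE' : E = maskedAdj s' := hE.trans
      (maskedAdj_congr (harr 0 rfl) (harr 2 rfl) (harr 3 rfl)).symm
    have key2 := ForProgram.loop_induction (p := roundProgram) (x := 5) (c := 1) (s := s')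
      (n := n) (fun j s' => s'.AuctionInv n E ∧
        ((∀ u < n, s'.Served n E u) ∨ i * (n + 1) + j ≤ priceSum n s')) rfl h0 hI ?_
    · rw [← add_one_mul] at key2
      exact key2
    · rintro j s'' hj h5 h0' hreg' harr' hI'
      have hE'' : E = maskedAdj s'' := hE'.trans
        (maskedAdj_congr (harr' 0 rfl) (harr' 2 rfl) (harr' 3 rfl)).symm
      exact step _ s'' h0' hE'' hI'

/-! ### Characteristic vectors and the result of the auction. -/

/-- The vertices whose cells in the array `f` are nonzero. -/
def charSet (n : ℕ) (f : ℕ → ℕ) : Finset (Fin n) := Finset.univ.filter fun v => f v.val ≠ 0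

@[simp] theorem mem_charSet {n : ℕ} {f : ℕ → ℕ} {v : Fin n} : v ∈ charSet n f ↔ f v ≠ 0 := by
  simp [charSet]

/-- Array `0` holds the adjacency matrix, and array `2` the positions of its rows. -/
def HasGraph {n : ℕ} (G : SimpleGraph (Fin n)) (s : State) : Prop :=
  ∀ u v : Fin n, s.arr 0 (s.arr 2 u + v) ≠ 0 ↔ G.Adj u v

theorem den_auctionProgram {n : ℕ} {G : SimpleGraph (Fin n)} {s : State} (hn : s.reg 0 = n)
    (hG : HasGraph G s) :
    IsStablePairNumber G (charSet n (s.arr 3)) ((auctionProgram.den s).reg 7) := by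
  classical
  simp only [auctionProgram, ForProgram.den_seq, ForProgram.den_assign, State.setReg_reg, if_true,
    Expr.eval]
  set s1 := (ForProgram.tabulate 4 0 .skip (.const 0)).den s with hs1
  set s2 := (ForProgram.tabulate 5 0 .skip (.const 0)).den s1 with hs2
  set s3 := (ForProgram.tabulate 6 1 .skip (.const 0)).den s2 with hs3
  have h1 : s1.reg 0 = n := (ForProgram.den_reg_of_not_writes _ _ rfl).trans hn
  have h2 : s2.reg 0 = n := (ForProgram.den_reg_of_not_writes _ _ rfl).trans h1
  have h3 : s3.reg 0 = n := (ForProgram.den_reg_of_not_writes _ _ rfl).trans h2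
  have hp : ∀ i < n, s3.arr 4 i = 0 := by
    intro i hi
    rw [hs3, ForProgram.den_arr_of_not_writes _ _ rfl, hs2,
      ForProgram.den_arr_of_not_writes _ _ rfl]
    exact ForProgram.den_tabulate (fun _ y => y = 0) hn rfl rfl (fun _ => rfl)
      (fun _ _ _ _ _ _ _ => rfl) hi
  have ho : ∀ i < n, s3.arr 5 i = 0 := by
    intro i hi
    rw [hs3, ForProgram.den_arr_of_not_writes _ _ rfl]
    exact ForProgram.den_tabulate (fun _ y => y = 0) h1 rfl rfl (fun _ => rfl)
      (fun _ _ _ _ _ _ _ => rfl) hi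
  have hm : ∀ i < n + 1, s3.arr 6 i = 0 := fun i hi =>
    ForProgram.den_tabulate (fun _ y => y = 0) h2 rfl rfl (fun _ => rfl)
      (fun _ _ _ _ _ _ _ => rfl) hi
  have hfr : ∀ b, b ≠ 4 → b ≠ 5 → b ≠ 6 → s3.arr b = s.arr b := by
    intro b h4 h5 h6
    rw [hs3, ForProgram.den_arr_of_not_writes _ _ (by simpa [ForProgram.tabulate,
      ForProgram.writesArr] using h6.symm), hs2, ForProgram.den_arr_of_not_writes _ _
      (by simpa [ForProgram.tabulate, ForProgram.writesArr] using h5.symm), hs1,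
      ForProgram.den_arr_of_not_writes _ _ (by simpa [ForProgram.tabulate,
      ForProgram.writesArr] using h4.symm)]
  obtain ⟨hI, hS⟩ := den_rounds (E := maskedAdj s3) h3 rfl
    ⟨fun w hw => by simp [hp w hw], fun w hw h => by simp [hp w hw] at h,
      fun w hw _ => ho w hw, fun u hu h => absurd (hm (u + 1) (by omega)) h⟩
  have hfr4 : ∀ b, b ≠ 4 → b ≠ 5 → b ≠ 6 →
      ((ForProgram.loop 4 1 (.loop 5 1 roundProgram)).den s3).arr b = s.arr b := by
    intro b h4 h5 h6
    rw [ForProgram.den_arr_of_not_writes _ _ (by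
      simp [ForProgram.writesArr, roundProgram, serveProgram, levelProgram, ForProgram.when,
        bidProgram, h4.symm, h5.symm, h6.symm]), hfr b h4 h5 h6]
  have h4 : ((ForProgram.loop 4 1 (.loop 5 1 roundProgram)).den s3).reg 0 = n :=
    (ForProgram.den_reg_of_not_writes _ _ rfl).trans h3
  set s4 := (ForProgram.loop 4 1 (.loop 5 1 roundProgram)).den s3 with hs4
  set s5 := (ForProgram.count 1 10 (.cell 3 (.reg 1))).den s4 with hs5
  have h5 : s5.reg 0 = n := (ForProgram.den_reg_of_not_writes _ _ rfl).trans h4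
  have harr5 : s5.arr = s4.arr := ForProgram.den_count_arr _ _ _ _
  have h10 : s5.reg 10 = (charSet n (s.arr 3)).card := by
    rw [hs5, ForProgram.den_count_reg (fun i => s.arr 3 i ≠ 0) h4 (by decide) (by decide)
      (by decide), ForProgram.card_filter_range]
    · rfl
    · intro i s' hi h1 ha _
      simp [Expr.eval, h1, ha, hfr4 3]
  have h11 : ((ForProgram.count 1 11 (.and (.cell 3 (.reg 1))
      (.eq (.cell 4 (.reg 1)) (.const 0)))).den s5).reg 11
      = ((charSet n (s.arr 3)).filter fun v => s4.arr 4 v.val = 0).card := by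
    rw [ForProgram.den_count_reg (fun i => s.arr 3 i ≠ 0 ∧ s4.arr 4 i = 0) h5 (by decide)
      (by decide) (by decide), ForProgram.card_filter_range]
    · congr 1
      ext v
      simp
    · intro i s' hi h1 ha _
      rw [Expr.eval_and, Expr.eval_eq]
      simp [Expr.eval, h1, ha, harr5, hfr4 3]
  rw [h11, ForProgram.den_reg_of_not_writes _ _ rfl, h10]
  have hE : ∀ u v : Fin n, maskedAdj s3 u v ↔
      u ∈ charSet n (s.arr 3) ∧ v ∈ charSet n (s.arr 3) ∧ G.Adj u v := by
    intro u v
    rw [← hG u v]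
    simp [maskedAdj, hfr 0, hfr 2, hfr 3]
  -- Owners as a total function on vertices; its value at a vertex of price 0 is irrelevant.
  have hown : ∀ w : Fin n, ∃ u : Fin n, 0 < s4.arr 4 w →
      s4.arr 5 w = u + 1 ∧ s4.arr 6 (u + 1) = w + 1 ∧ maskedAdj s3 u w := by
    intro w
    by_cases hw : 0 < s4.arr 4 w
    · obtain ⟨u, hu, h⟩ := hI.owner w w.2 hw
      exact ⟨⟨u, hu⟩, fun _ => h⟩
    · exact ⟨w, fun h => absurd h hw⟩
  choose o ho' using hown
  refine isStablePairNumber_of_prices (n := n) ((Finset.card_le_univ _).trans_eq (by simp))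
    (fun v : Fin n => s4.arr 4 v) o ?_ ?_ ?_
  · intro w _ h
    have := (hE _ _).1 (ho' w h).2.2
    exact ⟨this.1, this.2.2⟩
  · intro w _ w' _ h h' he
    have k1 := (ho' w h).2.1
    have k2 := (ho' w' h').2.1
    rw [he] at k1
    exact Fin.ext (by omega)
  · intro u hu w hw huw hlt
    have hEuw := (hE u w).2 ⟨hu, hw, huw⟩
    rcases hS u u.2 with h | h
    · obtain ⟨v, hv, h1, h2, h3, h4⟩ := hI.mate u u.2 h
      have k := ho' ⟨v, hv⟩ h3
      have hou : o ⟨v, hv⟩ = u := Fin.ext (by have := k.1; simp only at this; omega)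
      exact ⟨⟨v, hv⟩, ((hE _ _).1 k.2.2).2.1, h3, hou, h4 w w.2 hEuw⟩
    · have := h w w.2 hEuw
      omega

/-! ### Computing a maximum stable set -/

section Greedy

open Classical in
/-- The vertices of `H` that are neither `v` nor adjacent to `v`. -/
noncomputable def removeNbhd {V : Type*} (G : SimpleGraph V) (H : Finset V) (v : V) : Finset V :=
  H.filter fun x => x ≠ v ∧ ¬ G.Adj v x

theorem mem_removeNbhd {V : Type*} {G : SimpleGraph V} {H : Finset V} {v x : V} :
    x ∈ removeNbhd G H v ↔ x ∈ H ∧ x ≠ v ∧ ¬ G.Adj v x := by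
  simp [removeNbhd]

/-- The stable set `S` can be extended within `H` to a stable set of size `k`, and `b` is the maximum
size of a stable pair in `H`. -/
structure GreedyInv {V : Type*} (G : SimpleGraph V) (k : ℕ) (H S : Finset V) (b : ℕ) : Prop where
  stable : S ∈ stableSets G
  not_adj : ∀ a ∈ S, ∀ h ∈ H, ¬ G.Adj a h
  notMem : ∀ a ∈ S, a ∉ H
  exists_isTight : ∃ T, IsTight G H T ∧ S.card + T.card = k ∧ b = 2 * T.card

variable {V : Type*} [DecidableEq V] {G : SimpleGraph V} {k b r : ℕ} {H S : Finset V} {v : V}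

/-- Remove a vertex of a maximum stable set, together with its neighbours. -/
theorem IsTight.removeNbhd {T : Finset V} (hT : IsTight G H T) (hv : v ∈ T)
    (hr : IsStablePairNumber G (removeNbhd G H v) r) (hb : r + 2 ≤ 2 * T.card) :
    IsTight G (RecoverableRobust.removeNbhd G H v) (T.erase v) := by
  refine ⟨mem_stableSets_of_subset (Finset.erase_subset _ _) hT.stable, ?_, fun A B h => ?_⟩
  · intro x hx
    rw [Finset.mem_erase] at hx
    exact mem_removeNbhd.2 ⟨hT.subset hx.2, hx.1,
      mem_stableSets_iff.1 hT.stable v hv x hx.2⟩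
  · have := hr.2 A B h
    have := Finset.card_erase_add_one hv
    omega

theorem IsStablePair.insert {A B : Finset V} (h : IsStablePair G (removeNbhd G H v) A B)
    (hv : v ∈ H) : IsStablePair G H (insert v A) (insert v B) ∧
      (insert v A).card + (insert v B).card = A.card + B.card + 2 := by
  have hvA : v ∉ A := fun hA => (mem_removeNbhd.1 (h.left_subset hA)).2.1 rfl
  have hvB : v ∉ B := fun hB => (mem_removeNbhd.1 (h.right_subset hB)).2.1 rfl
  refine ⟨⟨?_, ?_, ?_⟩, ?_⟩
  · exact Finset.insert_subset hv fun x hx => (mem_removeNbhd.1 (h.left_subset hx)).1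
  · exact Finset.insert_subset hv fun x hx => (mem_removeNbhd.1 (h.right_subset hx)).1
  · intro x hx y hy
    rw [Finset.mem_insert] at hx hy
    rcases hx with rfl | hx <;> rcases hy with rfl | hy
    · exact fun h => h.ne rfl
    · exact (mem_removeNbhd.1 (h.right_subset hy)).2.2
    · exact fun hxy => (mem_removeNbhd.1 (h.left_subset hx)).2.2 hxy.symm
    · exact h.not_adj x hx y hy
  · rw [Finset.card_insert_of_notMem hvA, Finset.card_insert_of_notMem hvB]
    omega

/-- Adding `v` to both sides of a maximum pair of the smaller set gives a maximum pair in `H`. Its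
majority with `T` is a tight stable set that contains `v`. -/
theorem GreedyInv.take (h : GreedyInv G k H S b) (hv : v ∈ H)
    (hr : IsStablePairNumber G (removeNbhd G H v) r) (hb : r + 2 = b) :
    GreedyInv G k (removeNbhd G H v) (insert v S) r := by
  obtain ⟨hS, hadj, hmem, T, hT, hcard, rfl⟩ := h
  obtain ⟨A, B, hAB, hle⟩ := hr.1
  obtain ⟨hpair, hc⟩ := hAB.insert hv
  have hM := hT.majority hpair (by omega)
  set M := (insert v A ∩ insert v B) ∪ (T ∩ (insert v A ∪ insert v B)) with hMdef
  have hvM : v ∈ M := by simp [hMdef]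
  have hMT : M.card = T.card := by
    have h1 := hM.card_le hT.stable hT.subset
    have h2 := hT.card_le hM.stable hM.subset
    omega
  have hvS : v ∉ S := fun h => hmem v h hv
  refine ⟨?_, ?_, ?_, M.erase v, hM.removeNbhd hvM hr (by omega), ?_, ?_⟩
  · rw [mem_stableSets_iff] at hS ⊢
    intro x hx y hy
    rw [Finset.mem_insert] at hx hy
    rcases hx with rfl | hx <;> rcases hy with rfl | hy
    · exact fun h => h.ne rfl
    · exact fun h => hadj y hy _ hv h.symm
    · exact hadj x hx _ hv
    · exact hS x hx y hy
  · intro x hx y hy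
    rw [Finset.mem_insert] at hx
    rcases hx with rfl | hx
    · exact (mem_removeNbhd.1 hy).2.2
    · exact hadj x hx y (mem_removeNbhd.1 hy).1
  · intro x hx hxH
    rw [Finset.mem_insert] at hx
    rcases hx with rfl | hx
    · exact (mem_removeNbhd.1 hxH).2.1 rfl
    · exact hmem x hx (mem_removeNbhd.1 hxH).1
  · have := Finset.card_erase_add_one hvM
    rw [Finset.card_insert_of_notMem hvS]
    omega
  · have := Finset.card_erase_add_one hvM
    omega

/-- If `v` were in `T`, then `T.erase v` would be tight in the smaller set, which forces `r + 2 =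
b`. So `T` survives the deletion of `v`. -/
theorem GreedyInv.discard (h : GreedyInv G k H S b)
    (hr : IsStablePairNumber G (removeNbhd G H v) r) (hv : v ∈ H) (hb : r + 2 ≠ b) :
    GreedyInv G k (H.erase v) S b := by
  obtain ⟨hS, hadj, hmem, T, hT, hcard, rfl⟩ := h
  have hle : r + 2 ≤ 2 * T.card := by
    obtain ⟨A, B, hAB, hle⟩ := hr.1
    obtain ⟨hpair, hc⟩ := hAB.insert hv
    have := hT.le _ _ hpair
    omega
  have hvT : v ∉ T := by
    intro hvT
    have h1 := hT.removeNbhd hvT hr hle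
    have h2 := h1.isStablePairNumber.unique hr
    have h3 := Finset.card_erase_add_one hvT
    omega
  refine ⟨hS, fun a ha x hx => hadj a ha x (Finset.mem_of_mem_erase hx),
    fun a ha hx => hmem a ha (Finset.mem_of_mem_erase hx), T, ⟨hT.stable, ?_, ?_⟩, hcard, rfl⟩
  · exact fun x hx => Finset.mem_erase.2 ⟨fun h => hvT (h ▸ hx), hT.subset hx⟩
  · exact fun A B h => hT.le A B ⟨h.left_subset.trans (Finset.erase_subset _ _),
      h.right_subset.trans (Finset.erase_subset _ _), h.not_adj⟩

end Greedy

/-- Decide whether the vertex in register `6` is taken into the stable set in array `1`; array `7`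
holds the remaining vertices, and register `8` the maximum size of a stable pair therein. -/
def tryProgram : ForProgram :=
  .seq (.tabulate 3 0 .skip (.and (.cell 7 (.reg 1))
      (.and (.not (.eq (.reg 1) (.reg 6))) (.not (adjExpr 6 1)))))
    (.seq auctionProgram
      (.ite (.eq (.add (.reg 7) (.const 2)) (.reg 8))
        (.seq (.store 1 (.reg 6) (.const 1))
          (.seq (.tabulate 7 0 .skip (.cell 3 (.reg 1))) (.assign 8 (.reg 7))))
        (.store 7 (.reg 6) (.const 0))))

/-- Compute a maximum stable set in array `1`. -/
def maxStableProgram : ForProgram :=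
  .seq (.tabulate 3 0 .skip (.const 1))
    (.seq auctionProgram
      (.seq (.assign 8 (.reg 7))
        (.seq (.tabulate 7 0 .skip (.const 1))
          (.loop 6 0 (.when (.cell 7 (.reg 6)) tryProgram)))))

theorem charSet_congr {n : ℕ} {f g : ℕ → ℕ} (h : ∀ v : Fin n, f v ≠ 0 ↔ g v ≠ 0) :
    charSet n f = charSet n g := by
  ext v
  simpa using h v

theorem charSet_update_zero {n : ℕ} (f : ℕ → ℕ) (v : Fin n) :
    charSet n (Function.update f v 0) = (charSet n f).erase v := by
  ext x
  by_cases hx : x = v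
  · subst hx; simp
  · have : x.val ≠ v.val := fun h => hx (Fin.ext h)
    simp [hx, this]

theorem charSet_update_one {n : ℕ} (f : ℕ → ℕ) (v : Fin n) :
    charSet n (Function.update f v 1) = insert v (charSet n f) := by
  ext x
  by_cases hx : x = v
  · subst hx; simp
  · have : x.val ≠ v.val := fun h => hx (Fin.ext h)
    simp [hx, this]

theorem HasGraph.congr {n : ℕ} {G : SimpleGraph (Fin n)} {s s' : State} (h : HasGraph G s)
    (h0 : s'.arr 0 = s.arr 0) (h2 : s'.arr 2 = s.arr 2) : HasGraph G s' := by
  intro u v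
  rw [h0, h2]
  exact h u v

theorem HasGraph.eval_adjExpr {n : ℕ} {G : SimpleGraph (Fin n)} {s : State} (h : HasGraph G s)
    {x y : ℕ} {u v : Fin n} (hx : s.reg x = u) (hy : s.reg y = v) :
    (adjExpr x y).eval s ≠ 0 ↔ G.Adj u v := by
  rw [← h u v]
  simp [adjExpr, Expr.eval, hx, hy]

/-- The inclusion records that `v` is settled in either case, so one pass over the vertices empties
the candidate set. -/
theorem den_tryProgram {n k : ℕ} {G : SimpleGraph (Fin n)} {s : State} (hn : s.reg 0 = n)
    (hG : HasGraph G s) {v : Fin n} (hv : s.reg 6 = v) (hvH : v ∈ charSet n (s.arr 7))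
    (h : GreedyInv G k (charSet n (s.arr 7)) (charSet n (s.arr 1)) (s.reg 8)) :
    GreedyInv G k (charSet n ((tryProgram.den s).arr 7)) (charSet n ((tryProgram.den s).arr 1))
        ((tryProgram.den s).reg 8) ∧
      charSet n ((tryProgram.den s).arr 7) ⊆ (charSet n (s.arr 7)).erase v := by
  classical
  rw [tryProgram, ForProgram.den_seq, ForProgram.den_seq]
  set mask : ForProgram := .tabulate 3 0 .skip (.and (.cell 7 (.reg 1))
      (.and (.not (.eq (.reg 1) (.reg 6))) (.not (adjExpr 6 1)))) with hmask
  set s1 := mask.den s with hs1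
  have h1r : ∀ y, y ≠ 1 → s1.reg y = s.reg y := fun y hy =>
    ForProgram.den_reg_of_not_writes _ _ (by
      simp [hmask, ForProgram.tabulate, ForProgram.writesReg, hy.symm])
  have h1a : ∀ b, b ≠ 3 → s1.arr b = s.arr b := fun b hb =>
    ForProgram.den_arr_of_not_writes _ _ (by
      simp [hmask, ForProgram.tabulate, ForProgram.writesArr, hb.symm])
  have hH : charSet n (s1.arr 3) = removeNbhd G (charSet n (s.arr 7)) v := by
    ext x
    rw [mem_charSet, mem_removeNbhd, mem_charSet]
    refine ForProgram.den_tabulate_fin (fun (x : Fin n) y =>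
      y ≠ 0 ↔ s.arr 7 x ≠ 0 ∧ x ≠ v ∧ ¬ G.Adj v x) hn rfl rfl (fun _ => rfl) ?_ x
    intro x s' h0 h1 ha hr
    have h6 : s'.reg 6 = v := (hr 6 (by decide) rfl).trans hv
    have hG' : HasGraph G s' := hG.congr (ha 0 (by decide)) (ha 2 (by decide))
    rw [Expr.eval_and, Expr.eval_and, Expr.eval_not, Expr.eval_not, Expr.eval_eq,
      ← hG'.eval_adjExpr h6 h1]
    simp [ForProgram.den, Expr.eval, h1, h6, ha 7, Fin.ext_iff]
  set s2 := auctionProgram.den s1 with hs2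
  have hr : IsStablePairNumber G (removeNbhd G (charSet n (s.arr 7)) v) (s2.reg 7) := by
    rw [← hH]
    exact den_auctionProgram ((h1r 0 (by decide)).trans hn)
      (hG.congr (h1a 0 (by decide)) (h1a 2 (by decide)))
  have h28 : s2.reg 8 = s.reg 8 :=
    (ForProgram.den_reg_of_not_writes _ _ rfl).trans (h1r 8 (by decide))
  have h26 : s2.reg 6 = v :=
    (ForProgram.den_reg_of_not_writes _ _ rfl).trans ((h1r 6 (by decide)).trans hv)
  have h20 : s2.reg 0 = n :=
    (ForProgram.den_reg_of_not_writes _ _ rfl).trans ((h1r 0 (by decide)).trans hn)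
  have ha7 : s2.arr 7 = s.arr 7 :=
    (ForProgram.den_arr_of_not_writes _ _ rfl).trans (h1a 7 (by decide))
  have ha1 : s2.arr 1 = s.arr 1 :=
    (ForProgram.den_arr_of_not_writes _ _ rfl).trans (h1a 1 (by decide))
  have ha3 : s2.arr 3 = s1.arr 3 := ForProgram.den_arr_of_not_writes _ _ rfl
  clear_value s2
  have hcond : (Expr.eq (.add (.reg 7) (.const 2)) (.reg 8)).eval s2 ≠ 0 ↔
      s2.reg 7 + 2 = s.reg 8 := by
    rw [Expr.eval_eq]
    simp [Expr.eval, h28]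
  rw [ForProgram.den]
  split_ifs with hc
  · rw [ForProgram.den_seq, ForProgram.den_seq, ForProgram.den_assign, State.setReg_arr]
    set s3 := (ForProgram.store 1 (.reg 6) (.const 1)).den s2 with hs3
    have h31 : s3.arr 1 = Function.update (s.arr 1) v 1 := by
      simp [hs3, ForProgram.den, Expr.eval, h26, ha1]
    have h33 : s3.arr 3 = s1.arr 3 := by
      simp [hs3, ForProgram.den, ha3]
    have h37 : charSet n (((ForProgram.tabulate 7 0 .skip (.cell 3 (.reg 1))).den s3).arr 7)
        = removeNbhd G (charSet n (s.arr 7)) v := by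
      rw [← hH]
      refine charSet_congr fun x => ?_
      rw [ForProgram.den_tabulate_fin (fun (x : Fin n) y => y = s1.arr 3 x) (s := s3) h20 rfl rfl
        (fun _ => rfl)]
      intro i s' _ h1 ha _
      simp [ForProgram.den, Expr.eval, h1, ha 3, h33]
    rw [h37, ForProgram.den_arr_of_not_writes _ _ rfl, h31, charSet_update_one]
    have h38 : ((((ForProgram.tabulate 7 0 .skip (.cell 3 (.reg 1))).den s3).setReg 8
        ((Expr.reg 7).eval ((ForProgram.tabulate 7 0 .skip (.cell 3 (.reg 1))).den s3))).reg 8)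
        = s2.reg 7 := by
      simp only [State.setReg_reg, if_true, Expr.eval]
      exact ForProgram.den_reg_of_not_writes _ _ rfl
    rw [h38]
    refine ⟨h.take hvH hr (hcond.1 hc), fun x hx => ?_⟩
    have := mem_removeNbhd.1 hx
    exact Finset.mem_erase.2 ⟨this.2.1, this.1⟩
  · have h37 : ((ForProgram.store 7 (.reg 6) (.const 0)).den s2).arr 7
        = Function.update (s.arr 7) v 0 := by
      simp [ForProgram.den, Expr.eval, h26, ha7]
    have h31 : ((ForProgram.store 7 (.reg 6) (.const 0)).den s2).arr 1 = s.arr 1 := by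
      simp [ForProgram.den, ha1]
    have h38 : ((ForProgram.store 7 (.reg 6) (.const 0)).den s2).reg 8 = s.reg 8 := by
      rw [ForProgram.den_reg_of_not_writes _ _ rfl, h28]
    rw [h37, h31, h38, charSet_update_zero]
    exact ⟨h.discard hr hvH fun h => hc (hcond.2 h), subset_rfl⟩

theorem den_greedyLoop {n : ℕ} {G : SimpleGraph (Fin n)} {s : State} (hn : s.reg 0 = n)
    (hG : HasGraph G s) {T : Finset (Fin n)}
    (h : GreedyInv G T.card (charSet n (s.arr 7)) (charSet n (s.arr 1)) (s.reg 8)) :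
    charSet n (((ForProgram.loop 6 0 (.when (.cell 7 (.reg 6)) tryProgram)).den s).arr 1)
        ∈ stableSets G ∧
      (charSet n (((ForProgram.loop 6 0 (.when (.cell 7 (.reg 6)) tryProgram)).den s).arr 1)).card
        = T.card := by
  classical
  have key := ForProgram.loop_induction (p := .when (.cell 7 (.reg 6)) tryProgram) (x := 6)
    (c := 0) (s := s) (n := n) (fun i s' =>
      GreedyInv G T.card (charSet n (s'.arr 7)) (charSet n (s'.arr 1)) (s'.reg 8) ∧
        ∀ x ∈ charSet n (s'.arr 7), i ≤ x.val) rfl hn ?_ ?_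
  · obtain ⟨⟨hS, -, -, T', hT', hcard, -⟩, hempty⟩ := key
    refine ⟨hS, ?_⟩
    -- No candidates are left, so the stable set built so far already has the target size.
    have : T' = ∅ := Finset.eq_empty_of_forall_notMem fun x hx => by
      have := hempty x (hT'.subset hx)
      have := x.2
      omega
    rw [this, Finset.card_empty] at hcard
    exact hcard
  · exact ⟨h, fun x _ => Nat.zero_le _⟩
  · rintro i s' hi h6 h0 hreg harr ⟨hI, hle⟩
    have hG' : HasGraph G s' := hG.congr (harr 0 rfl) (harr 2 rfl)
    rw [ForProgram.when, ForProgram.den]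
    have hcell : (Expr.cell 7 (.reg 6)).eval s' = s'.arr 7 i := by simp [Expr.eval, h6]
    rw [hcell]
    split_ifs with hc
    · have k := den_tryProgram h0 hG' (v := ⟨i, hi⟩) h6 (by simpa using hc) hI
      generalize tryProgram.den s' = s'' at k ⊢
      obtain ⟨k1, k2⟩ := k
      refine ⟨k1, fun x hx => ?_⟩
      have h3 := Finset.mem_erase.1 (k2 hx)
      have h4 := hle x h3.2
      have h5 : x.val ≠ i := fun h => h3.1 (Fin.ext h)
      omega
    · refine ⟨hI, fun x hx => ?_⟩
      have h4 := hle x hx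
      have h5 : x.val ≠ i := by
        rintro rfl
        exact (mem_charSet.1 hx) (not_not.1 hc)
      omega

theorem den_maxStableProgram {n : ℕ} {G : SimpleGraph (Fin n)} {s : State} (hn : s.reg 0 = n)
    (hG : HasGraph G s) (h1 : ∀ v : Fin n, s.arr 1 v = 0) {T : Finset (Fin n)}
    (hT : IsTight G Finset.univ T) :
    charSet n ((maxStableProgram.den s).arr 1) ∈ stableSets G ∧
      (charSet n ((maxStableProgram.den s).arr 1)).card = T.card := by
  classical
  rw [maxStableProgram, ForProgram.den_seq, ForProgram.den_seq, ForProgram.den_seq,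
    ForProgram.den_seq, ForProgram.den_assign]
  set s1 := (ForProgram.tabulate 3 0 .skip (.const 1)).den s with hs1
  have hn1 : s1.reg 0 = n := (ForProgram.den_reg_of_not_writes _ _ rfl).trans hn
  have hG1 : HasGraph G s1 := hG.congr (ForProgram.den_arr_of_not_writes _ _ rfl)
    (ForProgram.den_arr_of_not_writes _ _ rfl)
  have hmask : charSet n (s1.arr 3) = Finset.univ := by
    ext x
    rw [mem_charSet, ForProgram.den_tabulate_fin (fun _ y => y = 1) hn rfl rfl (fun _ => rfl)
      (fun _ _ _ _ _ _ => rfl)]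
    simp
  have h7 := den_auctionProgram hn1 hG1
  rw [hmask] at h7
  have hb := h7.unique hT.isStablePairNumber
  have hn2 : (auctionProgram.den s1).reg 0 = n :=
    (ForProgram.den_reg_of_not_writes _ _ rfl).trans hn1
  have ha2 : ∀ b, b = 0 ∨ b = 1 ∨ b = 2 → (auctionProgram.den s1).arr b = s.arr b := by
    rintro b (rfl | rfl | rfl) <;>
    rw [ForProgram.den_arr_of_not_writes _ _ rfl, hs1, ForProgram.den_arr_of_not_writes _ _ rfl]
  generalize auctionProgram.den s1 = s2 at *
  set s3 := s2.setReg 8 ((Expr.reg 7).eval s2) with hs3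
  have h38 : s3.reg 8 = 2 * T.card := by simp [hs3, Expr.eval, hb]
  have hn3 : s3.reg 0 = n := by
    simpa [hs3] using hn2
  have ha3 : ∀ b, b = 0 ∨ b = 1 ∨ b = 2 → s3.arr b = s.arr b := ha2
  set s4 := (ForProgram.tabulate 7 0 .skip (.const 1)).den s3 with hs4
  have h48 : s4.reg 8 = 2 * T.card := (ForProgram.den_reg_of_not_writes _ _ rfl).trans h38
  have hn4 : s4.reg 0 = n := (ForProgram.den_reg_of_not_writes _ _ rfl).trans hn3
  have ha4 : ∀ b, b = 0 ∨ b = 1 ∨ b = 2 → s4.arr b = s.arr b := by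
    intro b hb
    refine (ForProgram.den_arr_of_not_writes _ _ ?_).trans (ha3 b hb)
    rcases hb with (rfl | rfl | rfl) <;> rfl
  have h47 : charSet n (s4.arr 7) = Finset.univ := by
    ext x
    rw [mem_charSet, ForProgram.den_tabulate_fin (fun _ y => y = 1) hn3 rfl rfl (fun _ => rfl)
      (fun _ _ _ _ _ _ => rfl)]
    simp
  have h41 : charSet n (s4.arr 1) = ∅ := by
    ext x
    simp [ha4 1, h1]
  refine den_greedyLoop hn4 (hG.congr (ha4 0 (by simp)) (ha4 2 (by simp))) ?_
  rw [h47, h41, h48]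
  exact ⟨by rw [mem_stableSets_iff]; simp, by simp, by simp, T, hT, by simp, rfl⟩

/-! ### Recognizing coronas -/

/-- Write the positions of the rows of the adjacency matrix into array `2`. -/
def rowProgram : ForProgram :=
  .loop 1 0 (.store 2 (.add (.reg 1) (.const 1)) (.add (.cell 2 (.reg 1)) (.reg 0)))

/-- Write the degrees into array `8`. -/
def degreeProgram : ForProgram := .tabulate 8 0 (.count 3 10 (adjExpr 1 3)) (.reg 10)

/-- Write the numbers of neighbouring leaves into array `9`. -/
def leafCountProgram : ForProgram :=
  .tabulate 9 0 (.count 3 10 (.and (adjExpr 1 3) (.eq (.cell 8 (.reg 3)) (.const 1)))) (.reg 10)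

/-- Count in register `9` the vertices that violate the definition of a corona. -/
def coronaProgram : ForProgram :=
  .count 1 9 (.and (.not (.eq (.cell 8 (.reg 1)) (.const 1)))
    (.not (.eq (.cell 9 (.reg 1)) (.const 1))))

/-- Write the leaf set into array `1`. -/
def leafSetProgram : ForProgram :=
  .tabulate 1 0 (.count 3 10 (.and (adjExpr 1 3)
      (.not (.and (.eq (.cell 8 (.reg 3)) (.const 1)) (.not (.lt (.reg 1) (.reg 3)))))))
    (.and (.eq (.cell 8 (.reg 1)) (.const 1)) (.reg 10))

/-- Without multiplication, the offset `u * n` of row `u` is obtained by repeated addition. The last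
pass writes one harmless extra offset. -/
theorem den_rowProgram {n : ℕ} (G : SimpleGraph (Fin n)) :
    HasGraph G (rowProgram.den (inputState G)) := by
  have key := ForProgram.loop_induction
    (p := .store 2 (.add (.reg 1) (.const 1)) (.add (.cell 2 (.reg 1)) (.reg 0))) (x := 1)
    (c := 0) (s := inputState G) (n := n) (fun i s' => ∀ j ≤ i, s'.arr 2 j = j * n)
    rfl (by simp [inputState]) ?_ ?_
  · intro u v
    have h2 := key u u.2.le
    have h0 : (rowProgram.den (inputState G)).arr 0 = (inputState G).arr 0 :=
      ForProgram.den_arr_of_not_writes _ _ rfl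
    rw [h0, rowProgram, h2]
    simp only [inputState, true_and, ne_eq, ite_eq_right_iff, one_ne_zero, imp_false, not_not]
    refine ⟨?_, fun h => ⟨u, v, rfl, h⟩⟩
    rintro ⟨u', v', h, hadj⟩
    have hpos : 0 < n := u.pos
    have hu : u' = u := by
      have := congrArg (· / n) h
      simp only [Nat.mul_comm _ n, Nat.mul_add_div hpos,
        Nat.div_eq_of_lt v.2, Nat.div_eq_of_lt v'.2, add_zero] at this
      exact Fin.ext this.symm
    subst hu
    have hv : v' = v := Fin.ext (by omega)
    exact hv ▸ hadj
  · intro j hj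
    simp [inputState, Nat.le_zero.1 hj]
  · intro i s' hi h1 h0 _ _ hI j hj
    simp only [ForProgram.den, State.setReg_arr, State.setCell_arr, if_true, Expr.eval, h1, h0,
      Function.update_apply]
    split_ifs with h
    · rw [hI i le_rfl, h]; ring
    · exact hI j (by omega)

/-- Array `8` marks the leaves by the entry `1`. -/
def HasLeaves {n : ℕ} (G : SimpleGraph (Fin n)) (s : State) : Prop :=
  ∀ v : Fin n, s.arr 8 v = 1 ↔ IsLeaf G v

theorem den_degreeProgram {n : ℕ} {G : SimpleGraph (Fin n)} {s : State} (hn : s.reg 0 = n)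
    (hG : HasGraph G s) : HasLeaves G (degreeProgram.den s) := by
  classical
  refine ForProgram.den_tabulate_fin (fun v y => y = 1 ↔ IsLeaf G v) hn rfl rfl (fun _ => rfl) ?_
  intro v s' h0 h1 ha hr
  have hG' : HasGraph G s' := hG.congr (ha 0 (by decide)) (ha 2 (by decide))
  rw [Expr.eval, ForProgram.den_count_reg_fin (fun u => G.Adj v u) h0 (by decide) (by decide)
    (by decide)]
  · exact (Fintype.existsUnique_iff_card_one _).symm
  · intro u s'' h3 ha' hr'
    exact (hG'.congr (congrFun ha' 0) (congrFun ha' 2)).eval_adjExpr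
      ((hr' 1 (by decide) (by decide)).trans h1) h3

theorem den_leafCountProgram {n : ℕ} {G : SimpleGraph (Fin n)} {s : State} (hn : s.reg 0 = n)
    (hG : HasGraph G s) (hL : HasLeaves G s) (v : Fin n) :
    (leafCountProgram.den s).arr 9 v = 1 ↔ ∃! u, G.Adj v u ∧ IsLeaf G u := by
  classical
  refine ForProgram.den_tabulate_fin (fun v y => y = 1 ↔ ∃! u, G.Adj v u ∧ IsLeaf G u) hn rfl rfl
    (fun _ => rfl) ?_ v
  intro v s' h0 h1 ha hr
  have hG' : HasGraph G s' := hG.congr (ha 0 (by decide)) (ha 2 (by decide))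
  rw [Expr.eval, ForProgram.den_count_reg_fin (fun u => G.Adj v u ∧ IsLeaf G u) h0 (by decide)
    (by decide) (by decide)]
  · exact (Fintype.existsUnique_iff_card_one _).symm
  · intro u s'' h3 ha' hr'
    rw [Expr.eval_and, Expr.eval_eq, (hG'.congr (congrFun ha' 0) (congrFun ha' 2)).eval_adjExpr
      ((hr' 1 (by decide) (by decide)).trans h1) h3, ← hL u]
    simp [Expr.eval, h3, ha', ha 8]

theorem den_coronaProgram {n : ℕ} {G : SimpleGraph (Fin n)} {s : State} (hn : s.reg 0 = n)
    (hL : HasLeaves G s)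
    (h9 : ∀ v : Fin n, s.arr 9 v = 1 ↔ ∃! u, G.Adj v u ∧ IsLeaf G u) :
    (coronaProgram.den s).reg 9 = 0 ↔ IsCorona G := by
  classical
  rw [coronaProgram, ForProgram.den_count_reg_fin
    (fun v => ¬ IsLeaf G v ∧ ¬ ∃! u, G.Adj v u ∧ IsLeaf G u) hn (by decide) (by decide)
    (by decide), Finset.card_eq_zero, Finset.filter_eq_empty_iff]
  · simp only [IsCorona, Finset.mem_univ, true_imp_iff, not_and_or, not_not]
  · intro v s' h1 ha hr
    rw [Expr.eval_and, Expr.eval_not, Expr.eval_not, Expr.eval_eq,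
      Expr.eval_eq, ← hL v, ← h9 v]
    simp [Expr.eval, h1, ha]

theorem den_leafSetProgram {n : ℕ} {G : SimpleGraph (Fin n)} {s : State} (hn : s.reg 0 = n)
    (hG : HasGraph G s) (hL : HasLeaves G s) :
    charSet n ((leafSetProgram.den s).arr 1) = leafSet G := by
  classical
  ext v
  rw [mem_charSet, mem_leafSet]
  refine ForProgram.den_tabulate_fin (fun v y => y ≠ 0 ↔ IsLeaf G v ∧ ∃ u, G.Adj v u ∧
    (IsLeaf G u → v < u)) hn rfl rfl (fun _ => rfl) ?_ v
  intro v s' h0 h1 ha hr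
  have hG' : HasGraph G s' := hG.congr (ha 0 (by decide)) (ha 2 (by decide))
  rw [Expr.eval_and, Expr.eval_eq]
  simp only [Expr.eval]
  rw [ForProgram.den_count_reg_fin (fun u => G.Adj v u ∧ (IsLeaf G u → v < u)) h0 (by decide)
    (by decide) (by decide), ForProgram.den_reg_of_not_writes _ _ rfl, ForProgram.den_count_arr,
    h1, ha 8 (by decide), hL v, ← Nat.pos_iff_ne_zero, Finset.card_pos]
  -- A nonzero count of suitable neighbours expresses the existential quantifier.
  · simp [Finset.filter_nonempty_iff]
  · intro u s'' h3 ha' hr'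
    have h1' : s''.reg 1 = v := (hr' 1 (by decide) (by decide)).trans h1
    rw [Expr.eval_and, Expr.eval_not, Expr.eval_and, Expr.eval_eq, Expr.eval_not,
      Expr.eval_lt,
      (hG'.congr (congrFun ha' 0) (congrFun ha' 2)).eval_adjExpr h1' h3, ← hL u]
    simp [Expr.eval, h3, h1', ha', ha 8]

/-! ### The algorithm -/

/-- Compute an optimal solution in array `1` and its size in register `10`; register `9` is `0` if
and only if the graph is a corona. -/
def robustForProgram : ForProgram :=
  .seq rowProgram (.seq degreeProgram (.seq leafCountProgram (.seq coronaProgram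
    (.seq (.ite (.reg 9) maxStableProgram leafSetProgram) (.count 1 10 (.cell 1 (.reg 1)))))))

/-- The algorithm for unweighted robust stable set on König–Egerváry graphs. -/
def robustProgram : Program :=
  .seq robustForProgram.compile
    (.assign 0 (.sub (.reg 10) (.sub (.const 1) (.sub (.const 1) (.reg 9)))))

theorem den_robustForProgram {n : ℕ} {G : SimpleGraph (Fin n)} {T : Finset (Fin n)}
    (hT : IsTight G Finset.univ T) {s : State} (hs : s = robustForProgram.den (inputState G)) :
    s.reg 10 = (charSet n (s.arr 1)).card ∧
      (s.reg 9 = 0 ∧ IsCorona G ∧ charSet n (s.arr 1) = leafSet G ∨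
        s.reg 9 ≠ 0 ∧ ¬ IsCorona G ∧ charSet n (s.arr 1) ∈ stableSets G ∧
          (charSet n (s.arr 1)).card = T.card) := by
  classical
  rw [robustForProgram, ForProgram.den_seq, ForProgram.den_seq, ForProgram.den_seq,
    ForProgram.den_seq, ForProgram.den_seq] at hs
  have hG1 := den_rowProgram G
  set s1 := rowProgram.den (inputState G) with hs1
  have hn1 : s1.reg 0 = n := ForProgram.den_reg_of_not_writes _ _ rfl
  have hL2 := den_degreeProgram hn1 hG1
  set s2 := degreeProgram.den s1 with hs2
  have hn2 : s2.reg 0 = n := (ForProgram.den_reg_of_not_writes _ _ rfl).trans hn1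
  have hG2 : HasGraph G s2 := hG1.congr (ForProgram.den_arr_of_not_writes _ _ rfl)
    (ForProgram.den_arr_of_not_writes _ _ rfl)
  have hC3 := den_leafCountProgram hn2 hG2 hL2
  set s3 := leafCountProgram.den s2 with hs3
  have hn3 : s3.reg 0 = n := (ForProgram.den_reg_of_not_writes _ _ rfl).trans hn2
  have hL3 : HasLeaves G s3 := by
    intro v
    rw [hs3, ForProgram.den_arr_of_not_writes _ _ rfl]
    exact hL2 v
  have h9 := den_coronaProgram hn3 hL3 hC3
  set s4 := coronaProgram.den s3 with hs4
  have hn4 : s4.reg 0 = n := (ForProgram.den_reg_of_not_writes _ _ rfl).trans hn3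
  have harr4 : s4.arr = s3.arr := ForProgram.den_count_arr _ _ _ _
  have hL4 : HasLeaves G s4 := by
    intro v
    rw [harr4]
    exact hL3 v
  have hG4 : HasGraph G s4 := hG2.congr
    ((congrFun harr4 0).trans (ForProgram.den_arr_of_not_writes _ _ rfl))
    ((congrFun harr4 2).trans (ForProgram.den_arr_of_not_writes _ _ rfl))
  -- The greedy algorithm starts from the empty stable set, so array `1` must still be blank.
  have h41 : ∀ v : Fin n, s4.arr 1 v = 0 := by
    intro v
    rw [harr4, hs3, ForProgram.den_arr_of_not_writes _ _ rfl, hs2,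
      ForProgram.den_arr_of_not_writes _ _ rfl, hs1, ForProgram.den_arr_of_not_writes _ _ rfl]
    simp [inputState]
  set q : ForProgram := .ite (.reg 9) maxStableProgram leafSetProgram with hq
  set s5 := q.den s4 with hs5
  have hn5 : s5.reg 0 = n := (ForProgram.den_reg_of_not_writes _ _ rfl).trans hn4
  have h59 : s5.reg 9 = s4.reg 9 := ForProgram.den_reg_of_not_writes _ _ rfl
  have harr : s.arr = s5.arr := by rw [hs]; exact ForProgram.den_count_arr _ _ _ _
  have hs9 : s.reg 9 = s4.reg 9 := by
    rw [hs, ForProgram.den_reg_of_not_writes _ _ rfl, h59]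
  refine ⟨?_, ?_⟩
  · rw [harr, hs, ForProgram.den_count_reg_fin (fun v => s5.arr 1 v ≠ 0) hn5 (by decide)
      (by decide) (by decide)]
    · rfl
    · intro v s' h1 ha _
      simp [Expr.eval, h1, ha]
  · rw [harr, hs9]
    by_cases hc : s4.reg 9 = 0
    · refine .inl ⟨hc, h9.1 hc, ?_⟩
      have : s5 = leafSetProgram.den s4 := by
        rw [hs5, hq, ForProgram.den, if_neg (by simpa [Expr.eval] using hc)]
      rw [this]
      exact den_leafSetProgram hn4 hG4 hL4
    · refine .inr ⟨hc, fun h => hc (h9.2 h), ?_⟩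
      have : s5 = maxStableProgram.den s4 := by
        rw [hs5, hq, ForProgram.den, if_pos (by simpa [Expr.eval] using hc)]
      rw [this]
      exact den_maxStableProgram hn4 hG4 h41 hT

end RecoverableRobust

/-- Unweighted robust stable set is solvable in polynomial time on König–Egerváry graphs: one program
and one polynomial in the number of vertices work for all of these graphs. -/
theorem corollary5p3 :
    ∃ (P : RecoverableRobust.Program) (p : Polynomial ℕ),
      ∀ (n : ℕ) (G : SimpleGraph (Fin n)), RecoverableRobust.IsKonigEgervary G →
        RecoverableRobust.SolvesUnweightedRobustStableSet P G (p.eval n) := by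
  refine ⟨RecoverableRobust.robustProgram, RecoverableRobust.robustForProgram.cost + 8,
    fun n G hG => ?_⟩
  obtain ⟨T, hT⟩ := hG.exists_isTight
  obtain ⟨t, ht, hrun⟩ := RecoverableRobust.robustForProgram.exists_runs_compile
    (RecoverableRobust.inputState G) rfl
  obtain ⟨h10, h9⟩ := RecoverableRobust.den_robustForProgram hT rfl
  set s := RecoverableRobust.robustForProgram.den (RecoverableRobust.inputState G) with hs
  refine ⟨_, _, .seq hrun (.assign _ _ _), ?_, ?_⟩
  · rw [Polynomial.eval_add, Polynomial.eval_ofNat]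
    -- The final assignment takes exactly 8 steps.
    exact Nat.add_le_add ht (by decide)
  · have hval : RecoverableRobust.outputValue (s.setReg 0 (RecoverableRobust.Expr.eval s
        (.sub (.reg 10) (.sub (.const 1) (.sub (.const 1) (.reg 9))))))
        = (RecoverableRobust.charSet n (s.arr 1)).card - (1 - (1 - s.reg 9)) := by
      simp [RecoverableRobust.outputValue, RecoverableRobust.Expr.eval, h10]
    rw [hval]
    change RecoverableRobust.IsRobustOptimal _ _ (RecoverableRobust.charSet n (s.arr 1)) ∧
      _ = RecoverableRobust.worstCaseWeight _ _ (RecoverableRobust.charSet n (s.arr 1))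
    rcases h9 with ⟨h0, hc, hl⟩ | ⟨h0, hc, hst, hcard⟩
    · rw [h0, hl]
      exact hc.isRobustOptimal
    -- The truncated term `1 - (1 - x)` is `min x 1`: one is subtracted from the size exactly if
    -- some vertex violates the corona condition.
    · rw [show 1 - (1 - s.reg 9) = 1 by omega]
      exact RecoverableRobust.isRobustOptimal_of_not_isCorona hT hc hst hcard
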